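/- Trees are finite ordered trees over ranked alphabets; a letter may have several (finitely many) arities. For trees $s$ over $\Sigma$ and $t$ over $\Gamma$, the convolution $s\otimes t$ is the tree over $(\Sigma\cup\{\bot\})\times(\Gamma\cup\{\bot\})$ whose domain is $\mathrm{dom}_s\cup\mathrm{dom}_t$ and whose label at each node is the pair of the labels of $s$ and $t$, with $\bot$ where the node is missing. A deterministic top-down tree automaton (D$\downarrow$TA) has one initial state and at most one transition $(q,f,q_1,\dots,q_i)$ for each state $q$, letter $f$ and arity $i$ of $f$; it accepts a tree if it has a run on it. A D$\downarrow$TA recognizes a relation $R\subseteq T_\Sigma\times T_\Gamma$ if the tree language it accepts is exactly $\{s\otimes t\mid (s,t)\in R\}$. A deterministic top-down tree transducer (DTDT) has finitely many states, an initial state, and finitely many rules $q(f(x_1,\dots,x_i))\to w[q_1(x_{j_1}),\dots,q_n(x_{j_n})]$, where $f\in\Sigma$ has arity $i$, $w$ is an $n$-context over $\Gamma$ and $j_1,\dots,j_n\in\{1,\dots,i\}$, no two of them with the same left-hand side; it induces a partial function $T_\Sigma\rightharpoonup T_\Gamma$ in the usual way, by rewriting from the initial state at the root. It is without delay if every rule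 has the form $q(f(x_1,\dots,x_i))\to g(q_1(x_{j_1}),\dots,q_n(x_{j_n}))$ with a single output letter $g\in\Gamma$ of arity $n$, so that each input letter read and the output letter produced for it lie on the same tree level. It uniformizes $R$ with input validation if the function it induces is defined exactly on $\mathrm{dom}(R)=\{s\mid \exists t\,(s,t)\in R\}$ and maps every $s\in\mathrm{dom}(R)$ to some $t$ with $(s,t)\in R$. **Theorem.** The following problem is decidable: given ranked alphabets $\Sigma,\Gamma$ and a D$\downarrow$TA recognizing a relation $R\subseteq T_\Sigma\times T_\Gamma$ whose domain $\mathrm{dom}(R)$ is recognized by some D$\downarrow$TA over $\Sigma$, does $R$ have a uniformization with input validation by a DTDT without delay? That is, there is a total computable function that answers this question correctly for all such $\Sigma$, $\Gamma$ and automata. -/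

import Mathlib

namespace TreeUnif

/-! ### Ranked alphabets and finite ordered trees -/

/-- A ranked alphabet, given as the finite list of all pairs `(f, i)` such that `i` is one of the
arities of the letter `f`. A letter may have several arities. Letters are named by naturals. -/
abbrev RankedAlphabet := List (ℕ × ℕ)

/-- `S.HasRank f i`: the letter `f` belongs to `Σ_i`. -/
def RankedAlphabet.HasRank (S : RankedAlphabet) (f i : ℕ) : Prop := (f, i) ∈ S

/-- Finite ordered trees with labels in `α`. Successors are numbered `0, …, n - 1`. -/
inductive LTree (α : Type) : Type
  | node (a : α) (n : ℕ) (c : Fin n → LTree α) : LTree α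

namespace LTree

variable {α β : Type}

/-- Every node has a number of successors that is an arity of its label. -/
def WF (rk : α → ℕ → Prop) : LTree α → Prop
  | node a n c => rk a n ∧ ∀ i, WF rk (c i)

/-- Relabelling of a tree. -/
def map (h : α → β) : LTree α → LTree β
  | node a n c => node (h a) n fun i => map h (c i)

/-- The subtree at a position, if the position belongs to the domain of the tree. -/
def subtree : LTree α → List ℕ → Option (LTree α)
  | t, [] => some t
  | node _ n c, j :: u => if h : j < n then subtree (c ⟨j, h⟩) u else none

/-- The convolution `s ⊗ t`; the padding symbol `⊥` is `none`. -/
def conv : LTree α → LTree β → LTree (Option α × Option β)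
  | node a n c, node b m d =>
    node (some a, some b) (max n m) fun i =>
      if hn : i.1 < n then
        if hm : i.1 < m then conv (c ⟨i.1, hn⟩) (d ⟨i.1, hm⟩)
        else (c ⟨i.1, hn⟩).map fun x => (some x, none)
      else
        (d ⟨i.1, (lt_max_iff.mp i.2).resolve_left hn⟩).map fun y => (none, some y)

end LTree

/-- `T_Σ`, the set of trees over a ranked alphabet. -/
def trees (S : RankedAlphabet) : Set (LTree ℕ) := {t | t.WF S.HasRank}

/-- Arities in `Σ_⊥`: the padding symbol has arity `0` only. -/
def padRank (S : RankedAlphabet) : Option ℕ → ℕ → Prop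
  | none, n => n = 0
  | some f, n => S.HasRank f n

/-- Arities in the ranked vector alphabet `Σ_⊥ × Γ_⊥`. -/
def pairRank (S G : RankedAlphabet) (p : Option ℕ × Option ℕ) (n : ℕ) : Prop :=
  ∃ i j, padRank S p.1 i ∧ padRank G p.2 j ∧ n = max i j

/-! ### Top-down tree automata -/

/-- A finite top-down tree automaton with letters in `α`; the states are named by naturals.
A transition `(q, f, q₁, …, qᵢ)` is the triple `(q, f, [q₁, …, qᵢ])`. -/
structure TopDownTA (α : Type) where
  states : List ℕ
  init : List ℕ
  trans : List (ℕ × α × List ℕ)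

namespace TopDownTA

variable {α : Type}

/-- An automaton as a triple of lists. -/
def equivProd (α : Type) :
    TopDownTA α ≃ List ℕ × List ℕ × List (ℕ × α × List ℕ) where
  toFun A := (A.states, A.init, A.trans)
  invFun p := ⟨p.1, p.2.1, p.2.2⟩
  left_inv _ := rfl
  right_inv _ := rfl

instance [Primcodable α] : Primcodable (TopDownTA α) := Primcodable.ofEquiv _ (equivProd α)

/-- The automaton is one over the ranked alphabet with the arities `rk`. -/
def WF (rk : α → ℕ → Prop) (A : TopDownTA α) : Prop :=
  (∀ q ∈ A.init, q ∈ A.states) ∧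
  ∀ r ∈ A.trans, r.1 ∈ A.states ∧ rk r.2.1 r.2.2.length ∧ ∀ p ∈ r.2.2, p ∈ A.states

/-- One initial state, and at most one transition for each state, letter and arity. -/
def Deterministic (A : TopDownTA α) : Prop :=
  (∃ q₀, ∀ q, q ∈ A.init ↔ q = q₀) ∧
  ∀ q f ps ps', (q, f, ps) ∈ A.trans → (q, f, ps') ∈ A.trans → ps.length = ps'.length → ps = ps'

/-- There is a run of `A` on the tree that labels the root with `q`. -/
def RunFrom (A : TopDownTA α) : ℕ → LTree α → Prop
  | q, .node a n c =>
    ∃ p : Fin n → ℕ, (q, a, List.ofFn p) ∈ A.trans ∧ ∀ i, RunFrom A (p i) (c i)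

/-- The recognized tree language `T(A)`. -/
def language (rk : α → ℕ → Prop) (A : TopDownTA α) : Set (LTree α) :=
  {t | t.WF rk ∧ ∃ q ∈ A.init, A.RunFrom q t}

end TopDownTA

/-- The deterministic top-down tree automaton `B` over `S` recognizes the tree language `L`. -/
def RecognizesLang (S : RankedAlphabet) (B : TopDownTA ℕ) (L : Set (LTree ℕ)) : Prop :=
  B.WF S.HasRank ∧ B.Deterministic ∧ B.language S.HasRank = L

/-- The deterministic top-down tree automaton `A` over `Σ_⊥ × Γ_⊥` recognizes the relation
`R ⊆ T_Σ × T_Γ`: its language is the set of convolutions of the pairs in `R`. -/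
def RecognizesRel (S G : RankedAlphabet) (A : TopDownTA (Option ℕ × Option ℕ))
    (R : Set (LTree ℕ × LTree ℕ)) : Prop :=
  R ⊆ trees S ×ˢ trees G ∧ A.WF (pairRank S G) ∧ A.Deterministic ∧
  A.language (pairRank S G) = (fun p => LTree.conv p.1 p.2) '' R

/-- The domain of a binary relation. -/
def relDom {X Y : Type} (R : Set (X × Y)) : Set X := {x | ∃ y, (x, y) ∈ R}

/-- A uniformization: a function defined exactly on the domain of `R` that picks an image
under `R` for each element of it. -/
def IsUniformization {X Y : Type} (R : Set (X × Y)) (F : X →. Y) : Prop :=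
  F.Dom = relDom R ∧ ∀ x, ∀ y ∈ F x, (x, y) ∈ R

/-! ### Top-down tree transducers -/

/-- Trees with inner labels in `β` that may have leaves labelled in `κ` in addition. -/
inductive Term (β κ : Type) : Type
  | leaf (k : κ) : Term β κ
  | node (b : β) (n : ℕ) (c : Fin n → Term β κ) : Term β κ

namespace Term

variable {β κ l : Type}

/-- Correct arities at the nodes labelled in `β`, and the condition `P` at the other leaves. -/
def WF (rk : β → ℕ → Prop) (P : κ → Prop) : Term β κ → Prop
  | leaf k => P k
  | node b n c => rk b n ∧ ∀ i, WF rk P (c i)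

/-- Relabelling of the additional leaves. -/
def mapLeaf (h : κ → l) : Term β κ → Term β l
  | leaf k => leaf (h k)
  | node b n c => node b n fun i => mapLeaf h (c i)

/-- A tree without additional leaves. -/
def ofTree : LTree β → Term β κ
  | .node b n c => node b n fun i => ofTree (c i)

end Term

/-- Left-hand sides of rules: `q(f(x₁, …, xᵢ))`, or `q(x₁)` in an ε-transition. -/
inductive Lhs (Q : Type) : Type
  | read (q : Q) (f i : ℕ) : Lhs Q
  | eps (q : Q) : Lhs Q

/-- A top-down tree transducer with input alphabet `S`, output alphabet `G` and states `Q`.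
A right-hand side `w[q₁(x_{j₁}), …, qₙ(x_{jₙ})]`, with `w` an `n`-context, is the tree that has
the leaves `(q₁, j₁), …, (qₙ, jₙ)`, in this order, in place of the variables of `w`.
Variables are numbered from `0`. -/
structure TDT (S G : RankedAlphabet) (Q : Type) where
  init : Q
  rules : Set (Lhs Q × Term ℕ (Q × ℕ))
  finite_rules : rules.Finite
  read_wf : ∀ q f i w, (Lhs.read q f i, w) ∈ rules →
    S.HasRank f i ∧ w.WF G.HasRank fun k => k.2 < i
  eps_wf : ∀ q w, (Lhs.eps q, w) ∈ rules → w.WF G.HasRank fun k => k.2 = 0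

namespace TDT

variable {S G : RankedAlphabet} {Q : Type}

/-- The successor relation on the configurations with input tree `t`. In a configuration
`(t, t', φ)` the state-labelled leaf `u` of `t'`, with state `q`, carries the label `(q, φ(u))`. -/
inductive Step (T : TDT S G Q) (t : LTree ℕ) :
    Term ℕ (Q × List ℕ) → Term ℕ (Q × List ℕ) → Prop
  | read (q : Q) (v : List ℕ) (f i : ℕ) (c : Fin i → LTree ℕ) (w : Term ℕ (Q × ℕ))
      (hv : t.subtree v = some (.node f i c)) (hr : (Lhs.read q f i, w) ∈ T.rules) :
      Step T t (.leaf (q, v)) (w.mapLeaf fun k => (k.1, v ++ [k.2]))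
  | eps (q : Q) (v : List ℕ) (w : Term ℕ (Q × ℕ)) (hr : (Lhs.eps q, w) ∈ T.rules) :
      Step T t (.leaf (q, v)) (w.mapLeaf fun k => (k.1, v))
  | child (g n : ℕ) (c : Fin n → Term ℕ (Q × List ℕ)) (i : Fin n) (s : Term ℕ (Q × List ℕ))
      (h : Step T t (c i) s) :
      Step T t (.node g n c) (.node g n (Function.update c i s))

/-- The relation `R(T)` induced by the transducer. -/
def relation (T : TDT S G Q) : Set (LTree ℕ × LTree ℕ) :=
  {p | p.1 ∈ trees S ∧ p.2 ∈ trees G ∧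
    Relation.ReflTransGen (T.Step p.1) (.leaf (T.init, [])) (.ofTree p.2)}

/-- No ε-transitions, and no two rules with the same left-hand side. -/
def Deterministic (T : TDT S G Q) : Prop :=
  (∀ q w, (Lhs.eps q, w) ∉ T.rules) ∧
  ∀ lhs w w', (lhs, w) ∈ T.rules → (lhs, w') ∈ T.rules → w = w'

/-- Every rule has the form `q(f(x₁, …, xᵢ)) → g(q₁(x_{j₁}), …, qₙ(x_{jₙ}))` with `g` one
output letter of arity `n`. -/
def WithoutDelay (T : TDT S G Q) : Prop :=
  ∀ r ∈ T.rules, (∃ q f i, r.1 = Lhs.read q f i) ∧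
    ∃ (g n : ℕ) (k : Fin n → Q × ℕ), r.2 = .node g n fun l => .leaf (k l)

end TDT

/-- `R` has a uniformization (with input validation: the transducer produces an output exactly
for the inputs in the domain of `R`) by a deterministic top-down tree transducer without delay. -/
def HasUniformizationWithoutDelay (S G : RankedAlphabet) (R : Set (LTree ℕ × LTree ℕ)) : Prop :=
  ∃ (Q : Type) (_ : Finite Q) (T : TDT S G Q) (F : LTree ℕ →. LTree ℕ),
    T.Deterministic ∧ T.WithoutDelay ∧ T.relation = F.graph ∧ IsUniformization R F

end TreeUnif

/-!
The existence of a uniformizer is equivalent to the existence of a winning strategy in an infinite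
game with infinitely many positions, and it is decided by two-sided search for finite certificates.

**The game.** A transducer without delay produces an output node on the same level as the input
node it reads. All it has to know is what the automaton requires of the output subtree: to be
accepted from a state `q` together with the very input subtree that is read, as long as output and
input have not diverged (an item `(q, none)`), or to be accepted from `q` together with all trees
that the subtree at the output position may be (an item `(q, some x)` with a source `x`). Since the
automaton is deterministic, a set of items (a task) can be checked locally, see
`forall_domS_oacc_iff`. The domain of the relation is closed under exchange of subtrees, since some
deterministic automaton recognizes it. Therefore the inputs below a node that are still possible
are described by a list of sources depending on the path to the node only, and the subtrees at
different nodes are independent of each other (`closed_of_runFrom`).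

Input validation couples the copies of the transducer that read the same input node: each of them
sees only a part of the subtree, and together they have to reject all invalid inputs. So a position
of the game consists of a list of sources and the list of the tasks of all copies that read the
present node, with repetitions, as two copies with the same task can validate different parts. The
opponent names an input letter and a subtree, the copies choose outputs and directions; the
transducer loses where an invalid letter is read by no copy (`Lose`). A uniformizer yields a
strategy (`not_lose_of_fulfils`).

**Decidability.** If the opponent wins, then in boundedly many steps, because there are finitely
many choices in each step; this gives a certificate (`exists_noCert`). If not, then the positions
that are not lost have finitely many minimal elements for each set of tasks, with respect to
dropping copies, by Higman's lemma. Additional copies of a task can imitate a present one, so the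
transducer can stay within minimal positions, which gives a certificate (`exists_yesCert`) and also
a transducer with finitely many states (`YesCert.exists_transducer`). One of the certificates exists
for every instance, whether it meets the assumptions or not, so the search terminates
(`computablePred_lose`). The certificates are checked by bounded quantification over lists; the
auxiliary fixpoints (productive states, sources accepted without output) are expressed as
intersections and unions over all sublists of a list.
-/

namespace TreeUnif

/-! ### Trees that may be missing -/

section OptionTrees

variable {α β : Type}

/-- The label of the root; `none` for the missing tree. -/
def oroot : Option (LTree α) → Option α
  | none => none
  | some (.node a _ _) => some a

/-- The number of subtrees below the root; `0` for the missing tree. -/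
def oar : Option (LTree α) → ℕ
  | none => 0
  | some (.node _ n _) => n

/-- The `k`-th subtree below the root, if there is one. -/
def okid : Option (LTree α) → ℕ → Option (LTree α)
  | none, _ => none
  | some (.node _ n c), k => if h : k < n then some (c ⟨k, h⟩) else none

@[simp] lemma oroot_none : oroot (none : Option (LTree α)) = none := rfl
@[simp] lemma oar_none : oar (none : Option (LTree α)) = 0 := rfl
@[simp] lemma okid_none (k : ℕ) : okid (none : Option (LTree α)) k = none := rfl
@[simp] lemma oroot_node (a : α) (n : ℕ) (c : Fin n → LTree α) :
    oroot (some (.node a n c)) = some a := rfl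
@[simp] lemma oar_node (a : α) (n : ℕ) (c : Fin n → LTree α) :
    oar (some (.node a n c)) = n := rfl
lemma okid_node (a : α) (n : ℕ) (c : Fin n → LTree α) (k : ℕ) :
    okid (some (.node a n c)) k = if h : k < n then some (c ⟨k, h⟩) else none := rfl
@[simp] lemma okid_node_fin (a : α) (n : ℕ) (c : Fin n → LTree α) (k : Fin n) :
    okid (some (.node a n c)) k = some (c k) := by simp [okid_node]

lemma okid_isSome (os : Option (LTree α)) (k : ℕ) : (okid os k).isSome ↔ k < oar os := by
  rcases os with _ | ⟨a, n, c⟩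
  · simp
  · rw [okid_node, oar_node]
    split_ifs with h <;> simp [h]

lemma okid_isSome_eq (os : Option (LTree α)) (k : ℕ) :
    (okid os k).isSome = decide (k < oar os) := by
  have := okid_isSome os k
  by_cases h : k < oar os <;> simp_all

lemma okid_eq_none {os : Option (LTree α)} {k : ℕ} (h : oar os ≤ k) : okid os k = none := by
  have := okid_isSome os k
  cases hh : okid os k with
  | none => rfl
  | some x => rw [hh] at this; simp at this; omega

lemma oroot_isSome (os : Option (LTree α)) : (oroot os).isSome = os.isSome := by
  rcases os with _ | ⟨a, n, c⟩ <;> rfl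

lemma otree_ext {os os' : Option (LTree α)} (hr : oroot os = oroot os')
    (hk : ∀ k, okid os k = okid os' k) : os = os' := by
  have ha : oar os = oar os' := by
    have h : ∀ k, k < oar os ↔ k < oar os' := fun k => by
      rw [← okid_isSome, ← okid_isSome, hk]
    have h1 := h (oar os)
    have h2 := h (oar os')
    omega
  rcases os with _ | ⟨a, n, c⟩ <;> rcases os' with _ | ⟨a', n', c'⟩
  · rfl
  · simp at hr
  · simp at hr
  · simp only [oroot_node, Option.some.injEq, oar_node] at hr ha
    subst hr ha
    congr 2
    funext i
    simpa using hk i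

/-- A tree exists for each label and each choice of its subtrees. -/
lemma exists_otree (a : α) (n : ℕ) (kids : ℕ → Option (LTree α))
    (h : ∀ k, (kids k).isSome ↔ k < n) :
    ∃ t : LTree α, oroot (some t) = some a ∧ oar (some t) = n ∧
      ∀ k, okid (some t) k = kids k := by
  refine ⟨.node a n fun i => (kids i).get ((h i).2 i.2), rfl, rfl, fun k => ?_⟩
  rw [okid_node]
  split_ifs with hk
  · simp
  · have := (h k).not.2 hk
    simpa using (Option.not_isSome_iff_eq_none.1 this).symm

/-- Convolution of trees that may be missing. -/
def oconv : Option (LTree α) → Option (LTree β) → Option (LTree (Option α × Option β))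
  | none, none => none
  | some s, none => some (s.map fun x => (some x, none))
  | none, some t => some (t.map fun y => (none, some y))
  | some s, some t => some (s.conv t)

lemma oconv_eq_node (os : Option (LTree α)) (ot : Option (LTree β)) (h : os.isSome ∨ ot.isSome) :
    ∃ c, oconv os ot = some (.node (oroot os, oroot ot) (max (oar os) (oar ot)) c) ∧
      ∀ i, some (c i) = oconv (okid os i) (okid ot i) := by
  rcases os with _ | ⟨a, n, c⟩ <;> rcases ot with _ | ⟨b, m, d⟩
  · simp at h
  · have hm : max (oar (none : Option (LTree α))) (oar (some (.node b m d))) = m := by simp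
    rw [hm]
    exact ⟨_, rfl, fun i => by simp [oconv]⟩
  · have hm : max (oar (some (.node a n c))) (oar (none : Option (LTree β))) = n := by simp
    rw [hm]
    exact ⟨_, rfl, fun i => by simp [oconv]⟩
  · refine ⟨_, rfl, fun i => ?_⟩
    simp only [okid_node]
    have := i.2
    simp only [oar_node, lt_max_iff] at this
    split_ifs with h1 h2 h2
    · rfl
    · rfl
    · rfl
    · omega

lemma oconv_injective (x : LTree (Option α × Option β)) :
    ∀ (os os' : Option (LTree α)) (ot ot' : Option (LTree β)),
      oconv os ot = some x → oconv os' ot' = some x → os = os' ∧ ot = ot' := by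
  have key : ∀ (os : Option (LTree α)) (ot : Option (LTree β)) x, oconv os ot = some x →
      os.isSome ∨ ot.isSome := by
    rintro (_ | _) (_ | _) x h <;> simp_all [oconv]
  induction x with
  | node l n c ih =>
    intro os os' ot ot' h h'
    obtain ⟨d, hd, hk⟩ := oconv_eq_node os ot (key _ _ _ h)
    obtain ⟨d', hd', hk'⟩ := oconv_eq_node os' ot' (key _ _ _ h')
    rw [h] at hd
    rw [h'] at hd'
    simp only [Option.some.injEq, LTree.node.injEq] at hd hd'
    obtain ⟨rfl, hn, hc⟩ := hd
    obtain ⟨hl, hn', hc'⟩ := hd'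
    have kids : ∀ k, okid os k = okid os' k ∧ okid ot k = okid ot' k := by
      intro k
      by_cases hkn : k < n
      · have e1 : some (c ⟨k, hkn⟩) = oconv (okid os k) (okid ot k) := by
          subst hn
          rw [eq_of_heq hc]
          exact hk ⟨k, hkn⟩
        have e2 : some (c ⟨k, hkn⟩) = oconv (okid os' k) (okid ot' k) := by
          subst hn'
          rw [eq_of_heq hc']
          exact hk' ⟨k, hkn⟩
        exact ih _ _ _ _ _ e1.symm e2.symm
      · rw [okid_eq_none (os := os) (by omega), okid_eq_none (os := os') (by omega),
          okid_eq_none (os := ot) (by omega), okid_eq_none (os := ot') (by omega)]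
        exact ⟨rfl, rfl⟩
    simp only [Prod.mk.injEq] at hl
    exact ⟨otree_ext hl.1 fun k => (kids k).1, otree_ext hl.2 fun k => (kids k).2⟩

end OptionTrees

/-- A transition of an automaton over pairs of letters. -/
abbrev Tr := ℕ × (Option ℕ × Option ℕ) × List ℕ

/-- The automaton has a run from `q` on the convolution of `os` and `ot`, not both of which are
missing. -/
def OAcc (A : TopDownTA (Option ℕ × Option ℕ)) (q : ℕ) (os ot : Option (LTree ℕ)) : Prop :=
  ∃ x, oconv os ot = some x ∧ A.RunFrom q x

/-- The transition `tr` starts in `q`, reads the pair of letters `(a, b)` and has `n` successors. -/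
def TrMatch (tr : Tr) (q : ℕ) (a b : Option ℕ) (n : ℕ) : Prop :=
  tr.1 = q ∧ tr.2.1 = (a, b) ∧ tr.2.2.length = n

variable {A : TopDownTA (Option ℕ × Option ℕ)}

lemma oacc_iff {q : ℕ} {os ot : Option (LTree ℕ)} (h : os.isSome ∨ ot.isSome) :
    OAcc A q os ot ↔ ∃ tr ∈ A.trans, TrMatch tr q (oroot os) (oroot ot) (max (oar os) (oar ot)) ∧
      ∀ k < max (oar os) (oar ot), OAcc A (tr.2.2.getD k 0) (okid os k) (okid ot k) := by
  obtain ⟨c, hc, hk⟩ := oconv_eq_node os ot h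
  unfold OAcc
  simp only [hc, Option.some.injEq, exists_eq_left', TopDownTA.RunFrom]
  constructor
  · rintro ⟨p, hp, hr⟩
    refine ⟨_, hp, ⟨rfl, rfl, by simp⟩, fun k hkn => ⟨c ⟨k, hkn⟩, (hk ⟨k, hkn⟩).symm, ?_⟩⟩
    convert! hr ⟨k, hkn⟩
    simp [List.getD, hkn]
  · rintro ⟨⟨q', l, ps⟩, htr, ⟨rfl, rfl, hlen⟩, hr⟩
    refine ⟨fun i => ps.getD i 0, ?_, fun i => ?_⟩
    · convert! htr
      refine List.ext_getElem (by simpa using hlen.symm) fun i h1 h2 => ?_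
      simp [List.getD, h2]
    · obtain ⟨x, hx, hrx⟩ := hr i i.2
      rw [← hk i, Option.some.injEq] at hx
      simpa [hx] using hrx

lemma oacc_some_some {q : ℕ} {s t : LTree ℕ} :
    OAcc A q (some s) (some t) ↔ A.RunFrom q (s.conv t) := by
  simp [OAcc, oconv]

/-- Two matching transitions of a deterministic automaton are equal. -/
lemma trMatch_unique (hA : A.Deterministic) {tr tr' : Tr} {q : ℕ} {a b : Option ℕ} {n : ℕ}
    (h : tr ∈ A.trans) (h' : tr' ∈ A.trans) (hm : TrMatch tr q a b n)
    (hm' : TrMatch tr' q a b n) : tr = tr' := by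
  obtain ⟨q1, l1, p1⟩ := tr
  obtain ⟨q2, l2, p2⟩ := tr'
  obtain ⟨rfl, rfl, h3⟩ := hm
  obtain ⟨h4, h5, h6⟩ := hm'
  simp only at h4 h5 h6
  subst h4 h5
  rw [hA.2 _ _ _ _ h h' (by simpa using h3.trans h6.symm)]

/-! ### Letters with arities, and trees over a ranked alphabet -/

/-- The letters of `S` with their arities, together with the padding symbol of arity `0`. -/
def letters (S : RankedAlphabet) : List (Option ℕ × ℕ) := (none, 0) :: S.map fun x => (some x.1, x.2)

@[simp] lemma none_mem_letters {S : RankedAlphabet} {n : ℕ} : (none, n) ∈ letters S ↔ n = 0 := by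
  simp [letters]

@[simp] lemma some_mem_letters {S : RankedAlphabet} {f n : ℕ} :
    (some f, n) ∈ letters S ↔ (f, n) ∈ S := by
  simp [letters]

/-- The tree is missing or a tree over the ranked alphabet. -/
def OWF (S : RankedAlphabet) (os : Option (LTree ℕ)) : Prop := ∀ s ∈ os, s ∈ trees S

@[simp] lemma owf_none {S : RankedAlphabet} : OWF S none := by simp [OWF]
@[simp] lemma owf_some {S : RankedAlphabet} {s : LTree ℕ} : OWF S (some s) ↔ s ∈ trees S := by
  simp [OWF]

lemma mem_trees_node {S : RankedAlphabet} {f n : ℕ} {c : Fin n → LTree ℕ} :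
    LTree.node f n c ∈ trees S ↔ (f, n) ∈ S ∧ ∀ i, c i ∈ trees S := by
  simp [trees, LTree.WF, RankedAlphabet.HasRank]

lemma owf_iff {S : RankedAlphabet} {os : Option (LTree ℕ)} :
    OWF S os ↔ (oroot os, oar os) ∈ letters S ∧ ∀ k, OWF S (okid os k) := by
  rcases os with _ | ⟨f, n, c⟩
  · simp
  · simp only [owf_some, mem_trees_node, oroot_node, oar_node, some_mem_letters]
    refine and_congr_right fun _ => ⟨fun h k => ?_, fun h i => by simpa using h i⟩
    rw [okid_node]
    split_ifs with hk
    · simpa using h _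
    · simp

/-- A relation recognized by an automaton consists of all pairs of trees whose convolution has a
run from the initial state. -/
lemma mem_rel_iff {S G : RankedAlphabet} {R : Set (LTree ℕ × LTree ℕ)}
    (h : RecognizesRel S G A R) {q₀ : ℕ} (hq : ∀ q, q ∈ A.init ↔ q = q₀) (s t : LTree ℕ) :
    (s, t) ∈ R ↔ s ∈ trees S ∧ t ∈ trees G ∧ OAcc A q₀ (some s) (some t) := by
  obtain ⟨hsub, hwf, hdet, hlang⟩ := h
  have hrun : ∀ (x : LTree (Option ℕ × Option ℕ)) q, A.RunFrom q x → x.WF (pairRank S G) := by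
    intro x
    induction x with
    | node l n c ih =>
      rintro q ⟨p, hp, hr⟩
      refine ⟨?_, fun i => ih i _ (hr i)⟩
      simpa using (hwf.2 _ hp).2.1
  rw [oacc_some_some]
  constructor
  · intro hst
    have h1 : s.conv t ∈ A.language (pairRank S G) := by
      rw [hlang]
      exact ⟨_, hst, rfl⟩
    obtain ⟨_, q, hq', hr⟩ := h1
    rw [hq] at hq'
    subst hq'
    exact ⟨(hsub hst).1, (hsub hst).2, hr⟩
  · rintro ⟨hs, ht, hr⟩
    have h1 : s.conv t ∈ A.language (pairRank S G) := ⟨hrun _ _ hr, _, (hq _).2 rfl, hr⟩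
    rw [hlang] at h1
    obtain ⟨⟨s', t'⟩, hR, he⟩ := h1
    obtain ⟨e1, e2⟩ := oconv_injective (s.conv t) (some s') (some s) (some t') (some t)
      (by simpa [oconv] using he) rfl
    simp only [Option.some.injEq] at e1 e2
    rwa [← e1, ← e2]

/-! ### Finite choices and fixpoints on lists -/

section Lists

variable {α : Type}

/-- All lists that pick one element from each of the given lists. -/
def sec : List (List α) → List (List α)
  | [] => [[]]
  | l :: L => l.flatMap fun a => (sec L).map (a :: ·)

lemma mem_sec {L : List (List α)} {z : List α} : z ∈ sec L ↔ List.Forall₂ (· ∈ ·) z L := by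
  induction L generalizing z with
  | nil => simp [sec]
  | cons l L ih =>
    simp only [sec, List.mem_flatMap, List.mem_map, ih]
    constructor
    · rintro ⟨a, ha, y, hy, rfl⟩
      exact .cons ha hy
    · rintro (_ | ⟨ha, hy⟩)
      exact ⟨_, ha, _, hy, rfl⟩

/-- All sublists of a list. -/
def pw (l : List α) : List (List α) := (sec (l.map fun a => [[], [a]])).map List.flatten

lemma mem_pw {l s : List α} : s ∈ pw l ↔ s.Sublist l := by
  simp only [pw, List.mem_map, mem_sec]
  constructor
  · rintro ⟨z, hz, rfl⟩
    induction l generalizing z with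
    | nil => cases hz; simp
    | cons a l ih =>
      rw [List.map_cons] at hz
      cases hz with
      | cons h1 h2 =>
        simp only [List.mem_cons, List.not_mem_nil, or_false] at h1
        rcases h1 with rfl | rfl
        · exact (ih _ h2).cons a
        · exact (ih _ h2).cons_cons a
  · intro h
    induction h with
    | slnil => exact ⟨[], by simp, rfl⟩
    | cons a h ih =>
      obtain ⟨z, hz, rfl⟩ := ih
      exact ⟨[] :: z, by simpa using hz, rfl⟩
    | cons_cons a h ih =>
      obtain ⟨z, hz, rfl⟩ := ih
      exact ⟨[a] :: z, by simpa using hz, rfl⟩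

open Classical in
/-- The least sublist of `univ` closed under `Φ`, as the intersection of all closed ones. -/
noncomputable def lfpList (univ : List α) (Φ : List α → α → Prop) : List α :=
  univ.filter fun x => ∀ C ∈ pw univ, (∀ y ∈ univ, Φ C y → y ∈ C) → x ∈ C

open Classical in
/-- The greatest sublist of `univ` all members of which satisfy `Φ`, as the union of all of
these. -/
noncomputable def gfpList (univ : List α) (Φ : List α → α → Prop) : List α :=
  univ.filter fun x => ∃ C ∈ pw univ, (∀ y ∈ C, Φ C y) ∧ x ∈ C

lemma mem_lfpList_of_step {univ : List α} {Φ : List α → α → Prop}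
    (mono : ∀ C D x, (∀ y ∈ C, y ∈ D) → Φ C x → Φ D x) {x : α} (hx : x ∈ univ)
    (h : Φ (lfpList univ Φ) x) : x ∈ lfpList univ Φ := by
  classical
  simp only [lfpList, List.mem_filter, hx, decide_eq_true_eq, true_and]
  intro C hC hcl
  refine hcl x hx (mono _ _ _ (fun y hy => ?_) h)
  simp only [lfpList, List.mem_filter, decide_eq_true_eq] at hy
  exact hy.2 C hC hcl

lemma lfpList_induction {univ : List α} {Φ : List α → α → Prop} {p : α → Prop}
    (h : ∀ C : List α, (∀ y ∈ C, p y) → ∀ x, Φ C x → p x) : ∀ x ∈ lfpList univ Φ, p x := by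
  classical
  intro x hx
  simp only [lfpList, List.mem_filter, decide_eq_true_eq] at hx
  have := hx.2 (univ.filter fun y => p y) (mem_pw.2 List.filter_sublist) fun y hy hy' =>
    List.mem_filter.2 ⟨hy, decide_eq_true (h _ (fun z hz => by simpa using (List.mem_filter.1 hz).2)
      y hy')⟩
  simpa using (List.mem_filter.1 this).2

lemma gfpList_step {univ : List α} {Φ : List α → α → Prop}
    (mono : ∀ C D x, (∀ y ∈ C, y ∈ D) → Φ C x → Φ D x) {x : α}
    (h : x ∈ gfpList univ Φ) : Φ (gfpList univ Φ) x := by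
  classical
  simp only [gfpList, List.mem_filter, decide_eq_true_eq] at h
  obtain ⟨-, C, hC, hcl, hx⟩ := h
  refine mono C _ _ (fun y hy => ?_) (hcl x hx)
  simp only [gfpList, List.mem_filter, decide_eq_true_eq]
  exact ⟨(mem_pw.1 hC).subset hy, C, hC, hcl, hy⟩

lemma mem_gfpList_of_coind {univ : List α} {Φ : List α → α → Prop} {p : α → Prop}
    (h : ∀ C : List α, (∀ y ∈ univ, p y → y ∈ C) → ∀ x, p x → Φ C x) {x : α} (hx : x ∈ univ)
    (hp : p x) : x ∈ gfpList univ Φ := by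
  classical
  simp only [gfpList, List.mem_filter, decide_eq_true_eq]
  refine ⟨hx, univ.filter fun y => p y, mem_pw.2 List.filter_sublist, fun y hy => ?_, ?_⟩
  · exact h _ (fun z hz hpz => List.mem_filter.2 ⟨hz, by simpa using hpz⟩) y
      (by simpa using (List.mem_filter.1 hy).2)
  · exact List.mem_filter.2 ⟨hx, by simpa using hp⟩

end Lists

/-! ### Productive states and expansions -/

/-- An instance of the decision problem. -/
abbrev Ctx := RankedAlphabet × RankedAlphabet × TopDownTA (Option ℕ × Option ℕ)

/-- A set of inputs: `none` stands for the missing tree only, and `some (q, b)` for the trees that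
have a run from `q` together with some output tree, which is missing if and only if `b` is
false. -/
abbrev Src := Option (ℕ × Bool)

/-- A source, a letter that may label the root of one of its inputs, and the sources of the
subtrees, one for each transition by which all subtrees can be completed. -/
abbrev Exp := Src × Option ℕ × List Src

variable (c : Ctx)

/-- The transitions of the automaton. -/
def Ctx.trans : List Tr := c.2.2.trans

/-- `(q, b, b')` is enabled by the triples in `C`: there is a transition from `q` whose letter is
padding in the first component iff `b` is false and in the second component iff `b'` is false, and
whose successors are in `C`. -/
def ProdStep (C : List (ℕ × Bool × Bool)) (x : ℕ × Bool × Bool) : Prop :=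
  ∃ lf ∈ letters c.1, ∃ lg ∈ letters c.2.1, ∃ tr ∈ c.trans,
    (lf.1.isSome = x.2.1 ∧ lg.1.isSome = x.2.2 ∧ (lf.1.isSome || lg.1.isSome) = true) ∧
    TrMatch tr x.1 lf.1 lg.1 (max lf.2 lg.2) ∧
    ∀ k < max lf.2 lg.2, (tr.2.2.getD k 0, decide (k < lf.2), decide (k < lg.2)) ∈ C

/-- The triples `(q, b, b')` such that some pair of trees, present according to `b` and `b'`, has
a run from `q`. -/
noncomputable def prodList : List (ℕ × Bool × Bool) :=
  lfpList ((c.trans.map Prod.fst) ×ˢ [true, false] ×ˢ [true, false]) (ProdStep c)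

/-- The pairs of trees described by a triple. -/
def PairSem (x : ℕ × Bool × Bool) (os ot : Option (LTree ℕ)) : Prop :=
  os.isSome = x.2.1 ∧ ot.isSome = x.2.2 ∧ OWF c.1 os ∧ OWF c.2.1 ot ∧ OAcc c.2.2 x.1 os ot

variable {c}

/-- Trees with prescribed letters at the root, and given subtrees. -/
lemma exists_owf {S : RankedAlphabet} {l : Option ℕ × ℕ} (hl : l ∈ letters S)
    (kids : ℕ → Option (LTree ℕ)) (hk : ∀ k, (kids k).isSome ↔ k < l.2)
    (hw : ∀ k, OWF S (kids k)) :
    ∃ os, OWF S os ∧ oroot os = l.1 ∧ oar os = l.2 ∧ ∀ k, okid os k = kids k := by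
  obtain ⟨_ | f, n⟩ := l
  · rw [none_mem_letters] at hl
    subst hl
    refine ⟨none, by simp, rfl, rfl, fun k => ?_⟩
    have := hk k
    simp only [not_lt_zero, iff_false, Bool.not_eq_true, Option.isSome_eq_false_iff,
      Option.isNone_iff_eq_none] at this
    simp [this]
  · obtain ⟨t, h1, h2, h3⟩ := exists_otree f n kids hk
    refine ⟨some t, owf_iff.2 ⟨by rwa [h1, h2], fun k => ?_⟩, h1, h2, h3⟩
    rw [h3]
    exact hw k

lemma mem_prodList {x : ℕ × Bool × Bool} :
    x ∈ prodList c ↔ ∃ os ot, PairSem c x os ot := by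
  constructor
  · refine lfpList_induction (p := fun x => ∃ os ot, PairSem c x os ot) (fun C hC x => ?_) x
    rintro ⟨lf, hlf, lg, hlg, tr, htr, ⟨h1, h2, h3⟩, hm, hk⟩
    have : ∀ k, ∃ p : Option (LTree ℕ) × Option (LTree ℕ),
        (p.1.isSome ↔ k < lf.2) ∧ (p.2.isSome ↔ k < lg.2) ∧ OWF c.1 p.1 ∧ OWF c.2.1 p.2 ∧
        (k < max lf.2 lg.2 → OAcc c.2.2 (tr.2.2.getD k 0) p.1 p.2) := by
      intro k
      by_cases hkl : k < max lf.2 lg.2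
      · obtain ⟨os, ot, e1, e2, e3, e4, e5⟩ := hC _ (hk k hkl)
        exact ⟨(os, ot), by simp [e1], by simp [e2], e3, e4, fun _ => e5⟩
      · simp only [lt_max_iff, not_or] at hkl
        exact ⟨(none, none), by simpa using hkl.1, by simpa using hkl.2, by simp, by simp,
          fun h => by simp only [lt_max_iff] at h; tauto⟩
    choose p p1 p2 p3 p4 p5 using this
    obtain ⟨os, a1, a2, a3, a4⟩ := exists_owf hlf (fun k => (p k).1) p1 p3
    obtain ⟨ot, b1, b2, b3, b4⟩ := exists_owf hlg (fun k => (p k).2) p2 p4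
    have i1 : os.isSome = lf.1.isSome := by rw [← a2, oroot_isSome]
    have i2 : ot.isSome = lg.1.isSome := by rw [← b2, oroot_isSome]
    refine ⟨os, ot, by rw [i1, h1], by rw [i2, h2], a1, b1, ?_⟩
    rw [oacc_iff (by rw [i1, i2]; simpa using h3), a2, a3, b2, b3]
    exact ⟨tr, htr, hm, fun k hkl => by rw [a4, b4]; exact p5 k hkl⟩
  · rintro ⟨os, ot, h⟩
    have mono : ∀ C D x, (∀ y ∈ C, y ∈ D) → ProdStep c C x → ProdStep c D x := by
      rintro C D x hCD ⟨lf, hlf, lg, hlg, tr, htr, h, hm, hk⟩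
      exact ⟨lf, hlf, lg, hlg, tr, htr, h, hm, fun k hkl => hCD _ (hk k hkl)⟩
    obtain ⟨q, b, b'⟩ := x
    obtain ⟨h1, h2, h3, h4, y, hy, hr⟩ := h
    induction y generalizing q b b' os ot with
    | node l n d ih =>
      have hs : os.isSome ∨ ot.isSome := by
        rcases os with _ | _ <;> rcases ot with _ | _ <;> simp_all [oconv]
      have hacc : OAcc c.2.2 q os ot := ⟨_, hy, hr⟩
      obtain ⟨tr, htr, hm, hk⟩ := (oacc_iff hs).1 hacc
      obtain ⟨d', hd, hkd⟩ := oconv_eq_node os ot hs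
      rw [hy] at hd
      simp only [Option.some.injEq, LTree.node.injEq] at hd
      obtain ⟨-, rfl, hdd⟩ := hd
      obtain rfl := eq_of_heq hdd
      refine mem_lfpList_of_step mono ?_ ?_
      · simp only [List.mem_product, List.mem_map]
        exact ⟨⟨tr, htr, hm.1⟩, by simp⟩
      · refine ⟨_, (owf_iff.1 h3).1, _, (owf_iff.1 h4).1, tr, htr, ⟨?_, ?_, ?_⟩, hm, ?_⟩
        · rw [oroot_isSome, h1]
        · rw [oroot_isSome, h2]
        · simpa [oroot_isSome] using hs
        · intro k hkl
          obtain ⟨z, hz, hrz⟩ := hk k hkl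
          refine ih ⟨k, hkl⟩ _ _ _ _ _ ?_ ?_ ((owf_iff.1 h3).2 k) ((owf_iff.1 h4).2 k)
            (hkd ⟨k, hkl⟩).symm ?_
          · exact okid_isSome_eq _ _
          · exact okid_isSome_eq _ _
          · have := hkd ⟨k, hkl⟩
            simp only [hz, Option.some.injEq] at this
            rwa [this]

variable (c) in
/-- The inputs described by a source. -/
def domS : Src → Option (LTree ℕ) → Prop
  | none, os => os = none
  | some (q, b), os => ∃ ot, PairSem c (q, true, b) os ot

variable (c) in
open Classical in
/-- All expansions of sources. -/
noncomputable def exps : List Exp :=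
  (none, none, []) :: ((c.1 ×ˢ letters c.2.1 ×ˢ c.trans).filter fun x =>
    TrMatch x.2.2 x.2.2.1 (some x.1.1) x.2.1.1 (max x.1.2 x.2.1.2) ∧
      ∀ k < max x.1.2 x.2.1.2,
        (x.2.2.2.2.getD k 0, decide (k < x.1.2), decide (k < x.2.1.2)) ∈ prodList c).map fun x =>
    (some (x.2.2.1, x.2.1.1.isSome), some x.1.1,
      (List.range x.1.2).map fun k => some (x.2.2.2.2.getD k 0, decide (k < x.2.1.2)))

/-- Each input described by a source arises by an expansion. -/
lemma exists_exp {x : Src} {os : Option (LTree ℕ)} (h : domS c x os) :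
    ∃ e ∈ exps c, e.1 = x ∧ e.2.1 = oroot os ∧ e.2.2.length = oar os ∧
      ∀ k, domS c (e.2.2.getD k none) (okid os k) := by
  rcases x with _ | ⟨q, b⟩
  · obtain rfl : os = none := h
    exact ⟨(none, none, []), by simp [exps], rfl, rfl, rfl, fun k => by simp [domS]⟩
  · obtain ⟨ot, h1, h2, h3, h4, h5⟩ := h
    simp only at h1 h2 h5
    obtain ⟨tr, htr, hm, hk⟩ := (oacc_iff (by simp [h1])).1 h5
    obtain ⟨f, hf⟩ : ∃ f, oroot os = some f := by
      rw [← Option.isSome_iff_exists, oroot_isSome, h1]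
    have hS := (owf_iff.1 h3).1
    rw [hf, some_mem_letters] at hS
    have sem : ∀ k < max (oar os) (oar ot), PairSem c
        (tr.2.2.getD k 0, decide (k < oar os), decide (k < oar ot)) (okid os k) (okid ot k) :=
      fun k hkl => ⟨okid_isSome_eq _ _, okid_isSome_eq _ _,
        (owf_iff.1 h3).2 k, (owf_iff.1 h4).2 k, hk k hkl⟩
    refine ⟨(some (q, b), some f, (List.range (oar os)).map fun k =>
      some (tr.2.2.getD k 0, decide (k < oar ot))), ?_, rfl, hf.symm, by simp, fun k => ?_⟩
    · simp only [exps, List.mem_cons, List.mem_map, List.mem_filter]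
      refine .inr ⟨((f, oar os), (oroot ot, oar ot), tr), ⟨?_, ?_⟩, ?_⟩
      · simp only [List.mem_product]
        exact ⟨hS, (owf_iff.1 h4).1, htr⟩
      · simp only [decide_eq_true_eq]
        refine ⟨⟨rfl, ?_, hm.2.2⟩, fun k hkl => mem_prodList.2 ⟨_, _, sem k hkl⟩⟩
        rw [hm.2.1, hf]
      · simp [hm.1, oroot_isSome, h2]
    · by_cases hkl : k < oar os
      · have := sem k (lt_max_of_lt_left hkl)
        simp only [List.getD, List.getElem?_map, List.getElem?_range hkl, Option.map_some,
          Option.getD_some, domS]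
        exact ⟨_, by simpa [hkl] using this⟩
      · simp [List.getD, okid_eq_none (not_lt.1 hkl), domS, hkl]

lemma domS_owf {x : Src} {os : Option (LTree ℕ)} (h : domS c x os) : OWF c.1 os := by
  rcases x with _ | ⟨q, b⟩
  · obtain rfl : os = none := h
    simp
  · obtain ⟨ot, h1, h2, h3, h4, h5⟩ := h
    exact h3

lemma domS_isSome {x : Src} {os : Option (LTree ℕ)} (h : domS c x os) :
    os.isSome = x.isSome := by
  rcases x with _ | ⟨q, b⟩
  · obtain rfl : os = none := h
    simp
  · obtain ⟨ot, h1, h2, h3, h4, h5⟩ := h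
    simpa using h1

lemma exp_spec {e : Exp} (he : e ∈ exps c) :
    e = (none, none, []) ∨ ∃ f q b, e.1 = some (q, b) ∧ e.2.1 = some f ∧
      (f, e.2.2.length) ∈ c.1 ∧ ∃ tr ∈ c.trans, ∃ lg ∈ letters c.2.1, lg.1.isSome = b ∧
      TrMatch tr q (some f) lg.1 (max e.2.2.length lg.2) ∧
      (∀ k < max e.2.2.length lg.2, (tr.2.2.getD k 0, decide (k < e.2.2.length),
        decide (k < lg.2)) ∈ prodList c) ∧
      ∀ k < e.2.2.length, e.2.2.getD k none = some (tr.2.2.getD k 0, decide (k < lg.2)) := by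
  simp only [exps, List.mem_cons, List.mem_map, List.mem_filter, decide_eq_true_eq] at he
  refine he.imp_right ?_
  rintro ⟨⟨⟨f, n⟩, lg, tr⟩, ⟨hmem, hm, hk⟩, rfl⟩
  simp only [List.mem_product] at hmem
  simp only [List.length_map, List.length_range]
  refine ⟨f, _, _, rfl, rfl, hmem.1, tr, hmem.2.2, lg, hmem.2.1, rfl, hm, hk, fun k hkn => ?_⟩
  simp [List.getD, hkn]

/-- Each source below an expansion has an input. -/
lemma exp_kid_nonempty {e : Exp} (he : e ∈ exps c) (k : ℕ) :
    ∃ os, domS c (e.2.2.getD k none) os := by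
  by_cases hk : k < e.2.2.length
  · obtain rfl | ⟨f, q, b, -, -, -, tr, -, lg, -, -, -, hp, hkid⟩ := exp_spec he
    · simp at hk
    · rw [hkid k hk]
      have := hp k (lt_max_of_lt_left hk)
      simp only [hk, decide_true] at this
      obtain ⟨os, ot, h⟩ := mem_prodList.1 this
      exact ⟨os, ot, h⟩
  · exact ⟨none, by simp [List.getD, hk, domS]⟩

lemma exp_kid_isSome {e : Exp} (he : e ∈ exps c) (k : ℕ) :
    (e.2.2.getD k none).isSome ↔ k < e.2.2.length := by
  by_cases hk : k < e.2.2.length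
  · obtain rfl | ⟨f, q, b, -, -, -, tr, -, lg, -, -, -, hp, hkid⟩ := exp_spec he
    · simp at hk
    · rw [hkid k hk]
      simp [hk]
  · simp [List.getD, hk]

/-- Inputs below an expansion can be put together to an input of its source. -/
lemma exists_domS_of_exp {e : Exp} (he : e ∈ exps c) (kids : ℕ → Option (LTree ℕ))
    (hkids : ∀ k, domS c (e.2.2.getD k none) (kids k)) :
    ∃ os, domS c e.1 os ∧ oroot os = e.2.1 ∧ oar os = e.2.2.length ∧ ∀ k, okid os k = kids k := by
  have hsome : ∀ k, (kids k).isSome ↔ k < e.2.2.length := fun k => by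
    rw [domS_isSome (hkids k), exp_kid_isSome he]
  obtain rfl | ⟨f, q, b, h1, h2, h3, tr, htr, lg, hlg, hb, hm, hp, hkid⟩ := exp_spec he
  · refine ⟨none, rfl, rfl, rfl, fun k => ?_⟩
    have := hkids k
    simp only [List.getD_nil, domS] at this
    simp [this]
  · have : ∀ k, ∃ ot : Option (LTree ℕ), (ot.isSome ↔ k < lg.2) ∧ OWF c.2.1 ot ∧
        (k < max e.2.2.length lg.2 → OAcc c.2.2 (tr.2.2.getD k 0) (kids k) ot) := by
      intro k
      by_cases hk : k < e.2.2.length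
      · have hd := hkids k
        rw [hkid k hk] at hd
        obtain ⟨ot, h1, h2, h3, h4, h5⟩ := hd
        exact ⟨ot, by simp [h2], h4, fun _ => h5⟩
      · have hno : kids k = none := by
          have := (hsome k).not.2 hk
          simpa using this
        by_cases hkl : k < lg.2
        · obtain ⟨os, ot, g1, g2, g3, g4, g5⟩ :=
            mem_prodList.1 (hp k (lt_max_of_lt_right hkl))
          simp only [hk, decide_false, Option.isSome_eq_false_iff,
            Option.isNone_iff_eq_none] at g1
          subst g1
          rw [hno]
          exact ⟨ot, by simp [g2], g4, fun _ => g5⟩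
        · exact ⟨none, by simpa using hkl, by simp, fun h => by
            simp only [lt_max_iff] at h; tauto⟩
    choose ot o1 o2 o3 using this
    obtain ⟨os, a1, a2, a3, a4⟩ := exists_owf (S := c.1) (l := (some f, e.2.2.length))
      (by simpa using h3) kids hsome (fun k => domS_owf (hkids k))
    obtain ⟨ot', b1, b2, b3, b4⟩ := exists_owf hlg ot o1 o2
    have hs : os.isSome = true := by rw [← oroot_isSome, a2]; rfl
    refine ⟨os, ?_, a2.trans h2.symm, a3, a4⟩
    rw [h1]
    refine ⟨ot', hs, by rw [← hb, ← b2, oroot_isSome], a1, b1, ?_⟩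
    rw [oacc_iff (by simp [hs]), a2, a3, b2, b3]
    exact ⟨tr, htr, hm, fun k hkl => by rw [a4, b4]; exact o3 k hkl⟩

/-! ### Outputs that fit all inputs of a source -/

/-- An output fits all inputs of a source if and only if the automaton can handle each expansion of
the source by one transition, below which the subtrees of the output fit the sources of the
expansion. -/
lemma forall_domS_oacc_iff (hA : c.2.2.Deterministic) {q : ℕ} {x : Src} {ot : Option (LTree ℕ)}
    (h : x.isSome ∨ ot.isSome) :
    (∀ os, domS c x os → OAcc c.2.2 q os ot) ↔
      ∀ e ∈ exps c, e.1 = x → ∃ tr ∈ c.trans,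
        TrMatch tr q e.2.1 (oroot ot) (max e.2.2.length (oar ot)) ∧
        ∀ k < max e.2.2.length (oar ot), ∀ os, domS c (e.2.2.getD k none) os →
          OAcc c.2.2 (tr.2.2.getD k 0) os (okid ot k) := by
  constructor
  · rintro hall e he rfl
    choose wit hwit using exp_kid_nonempty he
    obtain ⟨os, d1, d2, d3, d4⟩ := exists_domS_of_exp he wit hwit
    have hs : ∀ os, domS c e.1 os → (os.isSome ∨ ot.isSome) := fun os ho =>
      h.imp_left fun h' => by rw [domS_isSome ho, h']
    obtain ⟨tr, htr, hm, -⟩ := (oacc_iff (hs _ d1)).1 (hall _ d1)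
    rw [d2, d3] at hm
    refine ⟨tr, htr, hm, fun k hk os' ho' => ?_⟩
    obtain ⟨os'', e1, e2, e3, e4⟩ := exists_domS_of_exp he (Function.update wit k os') fun j => by
      by_cases hj : j = k
      · subst hj
        simpa using ho'
      · simpa [hj] using hwit j
    obtain ⟨tr', htr', hm', hk'⟩ := (oacc_iff (hs _ e1)).1 (hall _ e1)
    rw [e2, e3] at hm'
    rw [e3] at hk'
    obtain rfl := trMatch_unique hA htr htr' hm hm'
    simpa [e4] using hk' k hk
  · intro hall os ho
    obtain ⟨e, he, e1, e2, e3, e4⟩ := exists_exp ho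
    obtain ⟨tr, htr, hm, hk⟩ := hall e he e1
    rw [oacc_iff (h.imp_left fun h' => by rw [domS_isSome ho, h']), ← e2, ← e3]
    exact ⟨tr, htr, hm, fun k hkl => hk k hkl _ (e4 k)⟩

variable (c) in
/-- The states that occur as successors in transitions. -/
def succStates : List ℕ := c.trans.flatMap fun tr => tr.2.2

variable (c) in
/-- The sources that occur below expansions, and the source of the missing tree. -/
noncomputable def srcList : List Src := none :: (exps c).flatMap fun e => e.2.2

lemma getD_mem_succStates {tr : Tr} (h : tr ∈ c.trans) {k : ℕ} (hk : k < tr.2.2.length) :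
    tr.2.2.getD k 0 ∈ succStates c := by
  refine List.mem_flatMap.2 ⟨tr, h, ?_⟩
  simp [List.getD, hk]

lemma getD_mem_srcList {e : Exp} (h : e ∈ exps c) (k : ℕ) : e.2.2.getD k none ∈ srcList c := by
  by_cases hk : k < e.2.2.length
  · refine List.mem_cons_of_mem _ (List.mem_flatMap.2 ⟨e, h, ?_⟩)
    simp [List.getD, hk]
  · simp [List.getD, hk, srcList]

variable (c) in
/-- `(q, x)` stays correct for one step without output, below which the pairs in `C` occur. -/
def PadStep (C : List (ℕ × Src)) (y : ℕ × Src) : Prop :=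
  y.2.isSome = true ∧ ∀ e ∈ exps c, e.1 = y.2 → ∃ tr ∈ c.trans,
    TrMatch tr y.1 e.2.1 none e.2.2.length ∧
    ∀ k < e.2.2.length, (tr.2.2.getD k 0, e.2.2.getD k none) ∈ C

variable (c) in
/-- The pairs `(q, x)` such that all inputs of `x` are accepted from `q` with the output
missing. -/
noncomputable def padList : List (ℕ × Src) := gfpList (succStates c ×ˢ srcList c) (PadStep c)

lemma padStep_mono : ∀ C D x, (∀ y ∈ C, y ∈ D) → PadStep c C x → PadStep c D x := by
  rintro C D x hCD ⟨h, hall⟩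
  refine ⟨h, fun e he hx => ?_⟩
  obtain ⟨tr, htr, hm, hk⟩ := hall e he hx
  exact ⟨tr, htr, hm, fun k hkl => hCD _ (hk k hkl)⟩

lemma mem_padList (hA : c.2.2.Deterministic) {q : ℕ} {x : Src} (hq : q ∈ succStates c)
    (hx : x ∈ srcList c) (hs : x.isSome) :
    (q, x) ∈ padList c ↔ ∀ os, domS c x os → OAcc c.2.2 q os none := by
  constructor
  · intro h os hd
    obtain ⟨s, rfl⟩ : ∃ s, os = some s := by
      rw [← Option.isSome_iff_exists, domS_isSome hd, hs]
    clear hq hx hs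
    induction s generalizing q x with
    | node f n d ih =>
      have hsx : x.isSome := by rw [← domS_isSome hd]; rfl
      obtain ⟨-, hst⟩ := gfpList_step padStep_mono h
      obtain ⟨e, he, e1, e2, e3, e4⟩ := exists_exp hd
      obtain ⟨tr, htr, hm, hk⟩ := hst e he e1
      rw [oacc_iff (by simp)]
      simp only [oroot_node, oar_node, oroot_none, oar_none, Nat.max_zero] at e2 e3 ⊢
      rw [e3] at hk
      refine ⟨tr, htr, by rwa [← e2, ← e3], fun k hkn => ?_⟩
      have h4 := e4 k
      have hkd : okid (some (LTree.node f n d)) k = some (d ⟨k, hkn⟩) := by simp [okid_node, hkn]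
      rw [hkd] at h4 ⊢
      exact ih ⟨k, hkn⟩ (hk k hkn) h4
  · intro h
    refine mem_gfpList_of_coind (p := fun y : ℕ × Src => y.2.isSome = true ∧ ∀ os, domS c y.2 os →
      OAcc c.2.2 y.1 os none) ?_ (List.mem_product.2 ⟨hq, hx⟩) ⟨hs, h⟩
    rintro C hC ⟨q', x'⟩ ⟨hs', hall⟩
    refine ⟨hs', fun e he hex => ?_⟩
    obtain ⟨tr, htr, hm, hk⟩ := (forall_domS_oacc_iff hA (.inl hs')).1 hall e he hex
    simp only [oroot_none, oar_none, Nat.max_zero, okid_none] at hm hk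
    refine ⟨tr, htr, hm, fun k hkl => hC _ ?_ ⟨(exp_kid_isSome he k).2 hkl, hk k hkl⟩⟩
    exact List.mem_product.2 ⟨getD_mem_succStates htr (by rw [hm.2.2]; exact hkl),
      getD_mem_srcList he k⟩

/-! ### The validation game -/

/-- A requirement `(q, x)` on an output tree: if `x` is a source, it has to be accepted from `q`
together with each input of the source; if `x` is `none`, it has to be accepted from `q` together
with the very input tree it is produced from. -/
abbrev Item := ℕ × Option Src

/-- The requirements on the output of one copy of a transducer. -/
abbrev Task := List Item

/-- An output letter, and for each of its successors the index of the input subtree from which the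
output is continued. -/
abbrev Opt := ℕ × List ℕ

/-- A position of the game: what is known about the input tree below the present node, and the
tasks of all copies of the transducer that read this node. -/
abbrev Pos := List Src × List Task

section Game

variable (c : Ctx)

/-- The expansion `e` is to be taken into account for an item with second component `x`, when the
letter `f` with arity `n` is read from an input described by `P`. -/
def ExpMatch (P : List Src) (f n : ℕ) (x : Option Src) (e : Exp) : Prop :=
  (x = none ∧ e.1 ∈ P ∧ e.2.1 = some f ∧ e.2.2.length = n) ∨ x = some e.1

/-- Some input described by `P` has the letter `f` with arity `n` at the root. -/
def Feas (P : List Src) (f n : ℕ) : Prop := ∃ e ∈ exps c, ExpMatch P f n none e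

open Classical in
/-- What is known about the `k`-th subtree of an input described by `P` that has the letter `f`
with arity `n` at the root. -/
noncomputable def delta (P : List Src) (f n k : ℕ) : List Src :=
  ((exps c).filter fun e => ExpMatch P f n none e).map fun e => e.2.2.getD k none

/-- The second component of the item for the `k`-th subtree of the output: the output stays in step
with its input only if it is continued from the `k`-th subtree of the input. -/
def kidSrc (x : Option Src) (dirs : List ℕ) (e : Exp) (k : ℕ) : Option Src :=
  if x = none ∧ dirs[k]? = some k then none else some (e.2.2.getD k none)

/-- The automaton can handle the option `o` on all inputs that the task refers to; the input
subtrees without a counterpart in the output are accepted. -/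
def Valid (P : List Src) (f n : ℕ) (S : Task) (o : Opt) : Prop :=
  ∀ it ∈ S, ∀ e ∈ exps c, ExpMatch P f n it.2 e → ∃ tr ∈ c.trans,
    TrMatch tr it.1 e.2.1 (some o.1) (max e.2.2.length o.2.length) ∧
    ∀ k < max e.2.2.length o.2.length, o.2.length ≤ k →
      (tr.2.2.getD k 0, e.2.2.getD k none) ∈ padList c

/-- All items that may occur after the first step. -/
noncomputable def itemList : List Item := succStates c ×ˢ (none :: (srcList c).map some)

/-- The item `y` is required of the `k`-th subtree of the output. -/
def ItemStep (P : List Src) (f n : ℕ) (S : Task) (o : Opt) (k : ℕ) (y : Item) : Prop :=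
  ∃ it ∈ S, ∃ e ∈ exps c, ExpMatch P f n it.2 e ∧ ∃ tr ∈ c.trans,
    TrMatch tr it.1 e.2.1 (some o.1) (max e.2.2.length o.2.length) ∧
    y = (tr.2.2.getD k 0, kidSrc it.2 o.2 e k)

open Classical in
/-- The task of the copy that produces the `k`-th subtree of the output. -/
noncomputable def nextTask (P : List Src) (f n : ℕ) (S : Task) (o : Opt) (k : ℕ) : Task :=
  (itemList c).filter fun y => ItemStep c P f n S o k y

/-- All options at an input letter of arity `n`. -/
def opts (n : ℕ) : List Opt :=
  c.2.1.flatMap fun x => (sec (List.replicate x.2 (List.range n))).map fun dirs => (x.1, dirs)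

open Classical in
/-- The task together with all its valid options. -/
noncomputable def moves (P : List Src) (f n : ℕ) (S : Task) : List (Task × Opt) :=
  ((opts c n).filter fun o => Valid c P f n S o).map fun o => (S, o)

/-- The tasks of all copies that read the `k`-th subtree of the input next. -/
noncomputable def nextTasks (P : List Src) (f n k : ℕ) (z : List (Task × Opt)) : List Task :=
  z.flatMap fun x => ((List.range x.2.2.length).filter fun i => x.2.2[i]? = some k).map fun i =>
    nextTask c P f n x.1 x.2 i

/-- The positions lost for the transducer in finitely many steps. The opponent names an input
letter. If no valid input has it at the root, the input has to be rejected, which is impossible if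
no copy reads it. Otherwise each copy chooses a valid option, and then the opponent chooses the
subtree with which the game goes on. -/
inductive Lose : List Src → List Task → Prop
  | dead (P : List Src) (f n : ℕ) (hf : (f, n) ∈ c.1) (h : ¬ Feas c P f n) : Lose P []
  | step (P : List Src) (τ : List Task) (f n : ℕ) (κ : List (Task × Opt) → ℕ) (hf : (f, n) ∈ c.1)
      (h : Feas c P f n) (hκ : ∀ z ∈ sec (τ.map (moves c P f n)), κ z < n)
      (hl : ∀ z ∈ sec (τ.map (moves c P f n)),
        Lose (delta c P f n (κ z)) (nextTasks c P f n (κ z) z)) : Lose P τ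

variable {c}

lemma mem_opts {n : ℕ} {o : Opt} :
    o ∈ opts c n ↔ (o.1, o.2.length) ∈ c.2.1 ∧ ∀ d ∈ o.2, d < n := by
  obtain ⟨g, dirs⟩ := o
  have hsec : ∀ m, dirs ∈ sec (List.replicate m (List.range n)) ↔
      dirs.length = m ∧ ∀ d ∈ dirs, d < n := by
    intro m
    rw [mem_sec]
    induction m generalizing dirs with
    | zero => cases dirs <;> simp
    | succ m ih =>
      cases dirs with
      | nil => simp
      | cons d ds =>
        rw [List.replicate_succ, List.forall₂_cons, ih]
        simp
        tauto
  simp only [opts, List.mem_flatMap, List.mem_map, Prod.mk.injEq]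
  constructor
  · rintro ⟨⟨g', m⟩, hg, d, hd, rfl, rfl⟩
    obtain ⟨rfl, h⟩ := (hsec m).1 hd
    exact ⟨hg, h⟩
  · rintro ⟨hg, h⟩
    exact ⟨(g, dirs.length), hg, dirs, (hsec _).2 ⟨rfl, h⟩, rfl, rfl⟩

lemma mem_moves {P : List Src} {f n : ℕ} {S : Task} {y : Task × Opt} :
    y ∈ moves c P f n S ↔ y.1 = S ∧ y.2 ∈ opts c n ∧ Valid c P f n S y.2 := by
  obtain ⟨S', o⟩ := y
  simp only [moves, List.mem_map, List.mem_filter, decide_eq_true_eq, Prod.mk.injEq]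
  constructor
  · rintro ⟨o, h, rfl, rfl⟩
    exact ⟨rfl, h⟩
  · rintro ⟨rfl, h⟩
    exact ⟨o, h, rfl, rfl⟩

lemma mem_nextTask {P : List Src} {f n : ℕ} {S : Task} {o : Opt} {k : ℕ} {y : Item} :
    y ∈ nextTask c P f n S o k ↔ y ∈ itemList c ∧ ItemStep c P f n S o k y := by
  simp [nextTask]

lemma mem_sec_moves {P : List Src} {f n : ℕ} {τ : List Task} {z : List (Task × Opt)} :
    z ∈ sec (τ.map (moves c P f n)) ↔ List.Forall₂ (fun y S => y ∈ moves c P f n S) z τ := by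
  rw [mem_sec, List.forall₂_map_right_iff]

lemma mem_nextTasks {P : List Src} {f n k : ℕ} {z : List (Task × Opt)} {S : Task} :
    S ∈ nextTasks c P f n k z ↔
      ∃ x ∈ z, ∃ i, x.2.2[i]? = some k ∧ nextTask c P f n x.1 x.2 i = S := by
  simp only [nextTasks, List.mem_flatMap, List.mem_map, List.mem_filter, List.mem_range,
    decide_eq_true_eq]
  refine exists_congr fun x => and_congr_right fun _ => exists_congr fun i => and_congr_left
    fun _ => ⟨fun h => h.2, fun h => ⟨?_, h⟩⟩
  exact (List.getElem?_eq_some_iff.1 h).1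

/-- A set of positions in which the transducer can stay forever contains no lost position. -/
lemma not_lose_of_closed {W : Set Pos} (hW : ∀ p ∈ W, ∀ f n, (f, n) ∈ c.1 →
      (Feas c p.1 f n → ∃ z ∈ sec (p.2.map (moves c p.1 f n)), ∀ k < n,
        (delta c p.1 f n k, nextTasks c p.1 f n k z) ∈ W) ∧
      (¬ Feas c p.1 f n → p.2 ≠ [])) {p : Pos} (hp : p ∈ W) : ¬ Lose c p.1 p.2 := by
  intro h
  obtain ⟨P, τ⟩ := p
  simp only at h
  induction h with
  | dead P f n hf h => exact (hW _ hp f n hf).2 h rfl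
  | step P τ f n κ hf h hκ hl ih =>
    obtain ⟨z, hz, hk⟩ := (hW _ hp f n hf).1 h
    exact ih z hz (hk _ (hκ z hz))

/-- The opponent cannot force a lost position from one that is not lost. -/
lemma not_lose_step {P : List Src} {τ : List Task} (h : ¬ Lose c P τ) {f n : ℕ}
    (hf : (f, n) ∈ c.1) :
    (Feas c P f n → ∃ z ∈ sec (τ.map (moves c P f n)), ∀ k < n,
        ¬ Lose c (delta c P f n k) (nextTasks c P f n k z)) ∧
      (¬ Feas c P f n → τ ≠ []) := by
  constructor
  · intro hfe
    by_contra! hcon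
    choose! κ hκ using hcon
    exact h (.step P τ f n κ hf hfe (fun z hz => (hκ z hz).1) fun z hz => (hκ z hz).2)
  · rintro hfe rfl
    exact h (.dead P f n hf hfe)

/-! ### Finitely many positions suffice -/

lemma finite_lists {α : Type} {s : Set α} (hs : s.Finite) (N : ℕ) :
    {l : List α | l.length ≤ N ∧ ∀ x ∈ l, x ∈ s}.Finite := by
  have := hs.to_subtype
  refine ((List.finite_length_le s N).image (List.map Subtype.val)).subset ?_
  rintro l ⟨h1, h2⟩
  refine ⟨l.attachWith _ h2, by simpa using h1, by simp⟩

lemma finite_minimal_lists {α : Type} {s : Set α} (hs : s.Finite) (p : List α → Prop) :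
    {l : List α | (∀ x ∈ l, x ∈ s) ∧ p l ∧ ∀ l', p l' → l'.Sublist l → l' = l}.Finite := by
  have hpwo := Set.PartiallyWellOrderedOn.partiallyWellOrderedOn_sublistForall₂ (· = ·)
    (s := s) hs.partiallyWellOrderedOn
  refine IsAntichain.finite_of_partiallyWellOrderedOn (r := List.SublistForall₂ (· = ·)) ?_
    (hpwo.mono fun l hl => hl.1)
  rintro l hl l' hl' hne hsub
  obtain ⟨m, hm, hms⟩ := List.sublistForall₂_iff.1 hsub
  rw [List.forall₂_eq_eq_eq] at hm
  subst hm
  exact hne (hl'.2.2 _ hl.2.1 hms)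

lemma exists_minimal_sublist {α : Type} {p : List α → Prop} {l : List α} (h : p l) :
    ∃ l', l'.Sublist l ∧ p l' ∧ ∀ l'', p l'' → l''.Sublist l' → l'' = l' := by
  induction hn : l.length using Nat.strong_induction_on generalizing l with
  | _ n ih =>
    by_cases hmin : ∀ l'', p l'' → l''.Sublist l → l'' = l
    · exact ⟨l, List.Sublist.refl _, h, hmin⟩
    · push Not at hmin
      obtain ⟨l2, h2, hs, hne⟩ := hmin
      have hlt : l2.length < n := by
        subst hn
        exact lt_of_le_of_ne hs.length_le fun he => hne (hs.eq_of_length he)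
      obtain ⟨l3, h3, h4⟩ := ih _ hlt h2 rfl
      exact ⟨l3, h3.trans hs, h4⟩

variable (c) in
/-- The transducer can stay within the positions in `W`, if superfluous copies of tasks are
dropped after each step. -/
def YesCert (W : List Pos) : Prop :=
  ∀ p ∈ W, ∀ x ∈ c.1,
    (Feas c p.1 x.1 x.2 ∧ ∃ z ∈ sec (p.2.map (moves c p.1 x.1 x.2)), ∀ k < x.2, ∃ p' ∈ W,
      p'.1 = delta c p.1 x.1 x.2 k ∧ p'.2 ∈ pw (nextTasks c p.1 x.1 x.2 k z) ∧
      ∀ S ∈ nextTasks c p.1 x.1 x.2 k z, S ∈ p'.2) ∨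
    (¬ Feas c p.1 x.1 x.2 ∧ p.2 ≠ [])

/-- A choice for the members of a sublist extends to the whole list: the other members use choices
from `Z`. -/
lemma exists_mimic {α β : Type} {r : α → β → Prop} {Z : List α} {τ τ' : List β}
    (h : τ.Sublist τ') : ∀ {z : List α}, List.Forall₂ r z τ → (∀ S ∈ τ', ∃ y ∈ Z, r y S) →
      ∃ z', List.Forall₂ r z' τ' ∧ z.Sublist z' ∧ ∀ y ∈ z', y ∈ z ∨ y ∈ Z := by
  induction h with
  | slnil => exact fun h _ => ⟨_, h, List.Sublist.refl _, fun y hy => .inl hy⟩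
  | cons a h ih =>
    intro z hz hZ
    obtain ⟨z', h1, h2, h3⟩ := ih hz fun S hS => hZ S (List.mem_cons_of_mem _ hS)
    obtain ⟨y, hy, hr⟩ := hZ a List.mem_cons_self
    refine ⟨y :: z', .cons hr h1, h2.cons y, fun x hx => ?_⟩
    rcases List.mem_cons.1 hx with rfl | hx
    · exact .inr hy
    · exact h3 x hx
  | cons_cons a h ih =>
    rintro z hz hZ
    cases hz with
    | cons hr hz =>
      obtain ⟨z', h1, h2, h3⟩ := ih hz fun S hS => hZ S (List.mem_cons_of_mem _ hS)
      refine ⟨_ :: z', .cons hr h1, h2.cons_cons _, fun x hx => ?_⟩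
      rcases List.mem_cons.1 hx with rfl | hx
      · exact .inl List.mem_cons_self
      · exact (h3 x hx).imp_left (List.mem_cons_of_mem _)

/-- The dropped copies do no harm, as they can imitate a copy with the same task. -/
lemma YesCert.not_lose {W : List Pos} (hW : YesCert c W) {p : Pos} (hp : p ∈ W) :
    ¬ Lose c p.1 p.2 := by
  let V : Set Pos := {p | ∃ p' ∈ W, p'.1 = p.1 ∧ p'.2.Sublist p.2 ∧ ∀ S ∈ p.2, S ∈ p'.2}
  refine not_lose_of_closed (W := V) ?_ ⟨p, hp, rfl, List.Sublist.refl _, fun S hS => hS⟩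
  clear! p
  rintro ⟨P, τ'⟩ ⟨⟨P', τ⟩, hp, rfl, hs, hsub⟩ f n hf
  simp only at hs hsub ⊢
  rcases hW _ hp (f, n) hf with ⟨hfe, z, hz, hk⟩ | ⟨hfe, hne⟩
  · refine ⟨fun _ => ?_, fun h => absurd hfe h⟩
    rw [mem_sec_moves] at hz
    obtain ⟨z', hz', hzs, hz3⟩ := exists_mimic (Z := z) hs hz fun S hS => by
      obtain ⟨i, hi⟩ := List.getElem?_of_mem (hsub S hS)
      have hi' := List.getElem?_eq_some_iff.1 hi
      have hl : i < z.length := by rw [hz.length_eq]; exact hi'.1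
      refine ⟨z[i], List.getElem_mem _, ?_⟩
      have := List.Forall₂.get hz hl hi'.1
      simpa [hi'.2] using this
    refine ⟨z', mem_sec_moves.2 hz', fun k hkn => ?_⟩
    obtain ⟨p', hp', h1, h2, h3⟩ := hk k hkn
    refine ⟨p', hp', h1, (mem_pw.1 h2).trans (hzs.flatMap _), fun S hS => h3 S ?_⟩
    obtain ⟨x, hx, hi⟩ := mem_nextTasks.1 hS
    exact mem_nextTasks.2 ⟨x, by simpa using hz3 x hx, hi⟩
  · refine ⟨fun h => absurd h hfe, fun _ he => hne ?_⟩
    subst he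
    simpa using hs

/-- By Higman's lemma the positions that are not lost have finitely many minimal ones. -/
lemma exists_yesCert {P₀ : List Src} {S₀ : Task} (h : ¬ Lose c P₀ [S₀]) :
    ∃ W, YesCert c W ∧ (P₀, [S₀]) ∈ W := by
  classical
  let FP : Set (List Src) := {P₀} ∪
    {l | l.length ≤ (exps c).length ∧ ∀ x ∈ l, x ∈ {x | x ∈ srcList c}}
  let FT : Set Task := {S₀} ∪
    {l | l.length ≤ (itemList c).length ∧ ∀ x ∈ l, x ∈ {x | x ∈ itemList c}}
  have hFP : FP.Finite := (Set.finite_singleton _).union (finite_lists (List.finite_toSet _) _)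
  have hFT : FT.Finite := (Set.finite_singleton _).union (finite_lists (List.finite_toSet _) _)
  -- Minimal positions are taken for each set of tasks separately.
  let good (P : List Src) (X : Set Task) (τ : List Task) : Prop :=
    ¬ Lose c P τ ∧ ∀ S, S ∈ τ ↔ S ∈ X
  let M (P : List Src) (X : Set Task) : Set (List Task) :=
    {l | (∀ x ∈ l, x ∈ FT) ∧ good P X l ∧ ∀ l', good P X l' → l'.Sublist l → l' = l}
  let W : Set Pos := ⋃ P ∈ FP, ⋃ X ∈ {X | X ⊆ FT}, (fun τ => (P, τ)) '' M P X
  have hW : W.Finite := hFP.biUnion fun P _ => hFT.finite_subsets.biUnion fun X _ =>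
    (finite_minimal_lists hFT _).image _
  have below : ∀ P ∈ FP, ∀ τ : List Task, (∀ S ∈ τ, S ∈ FT) → ¬ Lose c P τ →
      ∃ τ', (P, τ') ∈ W ∧ τ'.Sublist τ ∧ ∀ S ∈ τ, S ∈ τ' := by
    intro P hP τ hτ hl
    obtain ⟨τ', h1, h2, h3⟩ := exists_minimal_sublist (p := good P {S | S ∈ τ})
      ⟨hl, fun S => Iff.rfl⟩
    refine ⟨τ', ?_, h1, fun S hS => (h2.2 S).2 hS⟩
    simp only [W, Set.mem_iUnion]
    exact ⟨P, hP, {S | S ∈ τ}, hτ, τ', ⟨fun x hx => hτ x (h1.subset hx), h2, h3⟩, rfl⟩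
  have hWp : ∀ p ∈ W, p.1 ∈ FP ∧ (∀ S ∈ p.2, S ∈ FT) ∧ ¬ Lose c p.1 p.2 := by
    intro p hp
    simp only [W, Set.mem_iUnion] at hp
    obtain ⟨P, hP, X, hX, τ, hτ, rfl⟩ := hp
    exact ⟨hP, hτ.1, hτ.2.1.1⟩
  refine ⟨(P₀, [S₀]) :: hW.toFinset.toList, ?_, List.mem_cons_self⟩
  intro p hp x hx
  have hp' : p.1 ∈ FP ∧ (∀ S ∈ p.2, S ∈ FT) ∧ ¬ Lose c p.1 p.2 := by
    rcases List.mem_cons.1 hp with rfl | hp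
    · exact ⟨.inl rfl, by simp [FT], h⟩
    · exact hWp p (by simpa using hp)
  obtain ⟨h1, h2⟩ := not_lose_step hp'.2.2 (f := x.1) (n := x.2) hx
  by_cases hfe : Feas c p.1 x.1 x.2
  · left
    obtain ⟨z, hz, hk⟩ := h1 hfe
    refine ⟨hfe, z, hz, fun k hkn => ?_⟩
    have hP : delta c p.1 x.1 x.2 k ∈ FP := by
      refine .inr ⟨(List.length_map _).trans_le (List.length_filter_le _ _), fun y hy => ?_⟩
      obtain ⟨e, he, rfl⟩ := List.mem_map.1 hy
      exact getD_mem_srcList (List.mem_filter.1 he).1 k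
    have hτ : ∀ S ∈ nextTasks c p.1 x.1 x.2 k z, S ∈ FT := by
      intro S hS
      obtain ⟨_, -, i, -, rfl⟩ := mem_nextTasks.1 hS
      exact .inr ⟨List.length_filter_le _ _, fun y hy => (List.mem_filter.1 hy).1⟩
    obtain ⟨τ', ht, hs, hsub⟩ := below _ hP _ hτ (hk k hkn)
    exact ⟨_, List.mem_cons_of_mem _ (by simpa using ht), rfl, mem_pw.2 hs, hsub⟩
  · exact .inr ⟨hfe, h2 hfe⟩

/-- The members of `N` are positions with ranks, and the opponent can lead each of them to members
of lower rank. -/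
def NoCert (c : Ctx) (N : List (Pos × ℕ)) : Prop :=
  ∀ p ∈ N, ∃ x ∈ c.1,
    (¬ Feas c p.1.1 x.1 x.2 ∧ p.1.2 = []) ∨
    (Feas c p.1.1 x.1 x.2 ∧ ∀ z ∈ sec (p.1.2.map (moves c p.1.1 x.1 x.2)), ∃ k < x.2, ∃ p' ∈ N,
      p'.1 = (delta c p.1.1 x.1 x.2 k, nextTasks c p.1.1 x.1 x.2 k z) ∧ p'.2 < p.2)

lemma lose_of_noCert {N : List (Pos × ℕ)} (h : NoCert c N) {p : Pos × ℕ} (hp : p ∈ N) :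
    Lose c p.1.1 p.1.2 := by
  obtain ⟨p, r⟩ := p
  induction r using Nat.strong_induction_on generalizing p with
  | _ r ih =>
    obtain ⟨⟨f, n⟩, hx, ⟨hfe, hnil⟩ | ⟨hfe, hz⟩⟩ := h _ hp
    · simp only at hnil hfe ⊢
      rw [hnil]
      exact .dead _ f n hx hfe
    · choose! κ hκ p' hp' he hlt using hz
      refine .step _ _ f n κ hx hfe hκ fun z hzm => ?_
      have := ih _ (hlt z hzm) (p' z).1 (hp' z hzm)
      rwa [he z hzm] at this

/-- Losing is witnessed by a finite list, as there are finitely many choices in each step. -/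
lemma exists_noCert {P : List Src} {τ : List Task} (h : Lose c P τ) :
    ∃ N, NoCert c N ∧ ∃ r, ((P, τ), r) ∈ N := by
  induction h with
  | dead P f n hf h =>
    refine ⟨[((P, []), 0)], ?_, 0, by simp⟩
    simp only [NoCert, List.mem_singleton, forall_eq]
    exact ⟨(f, n), hf, .inl ⟨h, by trivial⟩⟩
  | step P τ f n κ hf h hκ hl ih =>
    have key : ∀ L : List (List (Task × Opt)), (∀ z ∈ L, z ∈ sec (τ.map (moves c P f n))) →
        ∃ N, NoCert c N ∧ ∃ b, ∀ z ∈ L, ∃ r < b,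
          ((delta c P f n (κ z), nextTasks c P f n (κ z) z), r) ∈ N := by
      intro L
      induction L with
      | nil => exact fun _ => ⟨[], by simp [NoCert], 0, by simp⟩
      | cons z L ihL =>
        intro hL
        obtain ⟨N, hN, b, hb⟩ := ihL fun y hy => hL y (List.mem_cons_of_mem _ hy)
        obtain ⟨N', hN', r, hr⟩ := ih z (hL z List.mem_cons_self)
        refine ⟨N ++ N', ?_, max b (r + 1), ?_⟩
        · intro p hp
          rcases List.mem_append.1 hp with hp | hp
          · obtain ⟨x, hx, hh⟩ := hN p hp
            refine ⟨x, hx, hh.imp_right fun ⟨h1, h2⟩ => ⟨h1, fun z hz => ?_⟩⟩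
            obtain ⟨k, hk, p', hp', h3⟩ := h2 z hz
            exact ⟨k, hk, p', List.mem_append_left _ hp', h3⟩
          · obtain ⟨x, hx, hh⟩ := hN' p hp
            refine ⟨x, hx, hh.imp_right fun ⟨h1, h2⟩ => ⟨h1, fun z hz => ?_⟩⟩
            obtain ⟨k, hk, p', hp', h3⟩ := h2 z hz
            exact ⟨k, hk, p', List.mem_append_right _ hp', h3⟩
        · intro y hy
          rcases List.mem_cons.1 hy with rfl | hy
          · exact ⟨r, by simp, List.mem_append_right _ hr⟩
          · obtain ⟨r', h1, h2⟩ := hb y hy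
            exact ⟨r', lt_max_of_lt_left h1, List.mem_append_left _ h2⟩
    obtain ⟨N, hN, b, hb⟩ := key _ fun z hz => hz
    refine ⟨((P, τ), b) :: N, ?_, b, List.mem_cons_self⟩
    intro p hp
    rcases List.mem_cons.1 hp with rfl | hp
    · refine ⟨(f, n), hf, .inr ⟨h, fun z hz => ⟨κ z, hκ z hz, ?_⟩⟩⟩
      obtain ⟨r, h1, h2⟩ := hb z hz
      exact ⟨_, List.mem_cons_of_mem _ h2, rfl, h1⟩
    · obtain ⟨x, hx, hh⟩ := hN p hp
      refine ⟨x, hx, hh.imp_right fun ⟨h1, h2⟩ => ⟨h1, fun z hz => ?_⟩⟩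
      obtain ⟨k, hk, p', hp', h3⟩ := h2 z hz
      exact ⟨k, hk, p', List.mem_cons_of_mem _ hp', h3⟩

end Game

/-! ### The function computed by a transducer without delay -/

lemma subtree_append {α : Type} (t : LTree α) (u v : List ℕ) :
    t.subtree (u ++ v) = (t.subtree u).bind fun s => s.subtree v := by
  induction u generalizing t with
  | nil => simp [LTree.subtree]
  | cons j u ih =>
    obtain ⟨a, n, c⟩ := t
    simp only [List.cons_append, LTree.subtree]
    split_ifs with h
    · exact ih _
    · rfl

namespace TDT

variable {S G : RankedAlphabet} {Q : Type}

/-- From the state `r`, the transducer transforms the first tree into the second one. -/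
def Ev (T : TDT S G Q) : LTree ℕ → Q → LTree ℕ → Prop
  | .node f n c, r, t => ∃ (g m : ℕ) (k : Fin m → Q × ℕ),
      (Lhs.read r f n, Term.node g m fun l => .leaf (k l)) ∈ T.rules ∧
      ∃ d, t = .node g m d ∧ ∀ l, ∃ h : (k l).2 < n, Ev T (c ⟨_, h⟩) (k l).1 (d l)

/-- The value of a configuration with input tree `t`. -/
def TermEv (T : TDT S G Q) (t : LTree ℕ) : Term ℕ (Q × List ℕ) → LTree ℕ → Prop
  | .leaf x, y => ∃ s, t.subtree x.2 = some s ∧ T.Ev s x.1 y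
  | .node g n c, y => ∃ d, y = .node g n d ∧ ∀ i, TermEv T t (c i) (d i)

variable {T : TDT S G Q}

lemma termEv_ofTree (t y : LTree ℕ) : T.TermEv t (.ofTree y) y := by
  induction y with
  | node g n d ih => exact ⟨d, rfl, ih⟩

lemma termEv_of_step (hd : T.WithoutDelay) {t : LTree ℕ} {ξ ξ' : Term ℕ (Q × List ℕ)}
    (h : T.Step t ξ ξ') : ∀ y, T.TermEv t ξ' y → T.TermEv t ξ y := by
  induction h with
  | read q v f i c w hv hr =>
    intro y hy
    obtain ⟨-, g, n, k, hk⟩ := hd _ hr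
    simp only at hk
    subst hk
    obtain ⟨d, rfl, hd⟩ := hy
    refine ⟨_, hv, g, n, k, hr, d, rfl, fun l => ?_⟩
    obtain ⟨s, hs, he⟩ := hd l
    have hs' : t.subtree (v ++ [(k l).2]) = some s := hs
    rw [subtree_append, hv] at hs'
    simp only [Option.bind_some, LTree.subtree] at hs'
    split_ifs at hs' with hlt
    refine ⟨hlt, ?_⟩
    have : c ⟨(k l).2, hlt⟩ = s := by
      cases hh : c ⟨(k l).2, hlt⟩
      rw [hh] at hs'
      simpa [LTree.subtree] using hs'
    rw [this]
    exact he
  | eps q v w hr =>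
    obtain ⟨⟨_, _, _, h⟩, -⟩ := hd _ hr
    simp at h
  | child g n c i s h ih =>
    rintro y ⟨d, rfl, hd⟩
    refine ⟨d, rfl, fun j => ?_⟩
    have := hd j
    by_cases hj : j = i
    · subst hj
      rw [Function.update_self] at this
      exact ih _ this
    · rwa [Function.update_of_ne hj] at this

lemma reflTransGen_node {t : LTree ℕ} {g n : ℕ} {c d : Fin n → Term ℕ (Q × List ℕ)}
    (h : ∀ i, Relation.ReflTransGen (T.Step t) (c i) (d i)) :
    Relation.ReflTransGen (T.Step t) (.node g n c) (.node g n d) := by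
  classical
  have one : ∀ (c : Fin n → Term ℕ (Q × List ℕ)) i s, Relation.ReflTransGen (T.Step t) (c i) s →
      Relation.ReflTransGen (T.Step t) (.node g n c) (.node g n (Function.update c i s)) := by
    intro c i s hs
    induction hs with
    | refl => simpa using Relation.ReflTransGen.refl
    | tail _ h2 ih =>
      refine ih.tail ?_
      have := Step.child (T := T) (t := t) g n (Function.update c i _) i _
        (by rw [Function.update_self]; exact h2)
      simpa using this
  have key : ∀ F : Finset (Fin n), Relation.ReflTransGen (T.Step t) (.node g n c)
      (.node g n fun i => if i ∈ F then d i else c i) := by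
    intro F
    induction F using Finset.induction_on with
    | empty => simpa using Relation.ReflTransGen.refl
    | insert a F ha ih =>
      refine ih.trans ?_
      have := one (fun i => if i ∈ F then d i else c i) a (d a) (by simpa [ha] using h a)
      convert! this using 2
      funext i
      by_cases hi : i = a
      · subst hi
        simp
      · simp [hi]
  simpa using key Finset.univ

lemma reflTransGen_of_ev {t s : LTree ℕ} : ∀ {r : Q} {v : List ℕ} {y : LTree ℕ},
    t.subtree v = some s → T.Ev s r y →
      Relation.ReflTransGen (T.Step t) (.leaf (r, v)) (.ofTree y) := by
  induction s with
  | node f n c ih =>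
    rintro r v y hv ⟨g, m, k, hr, d, rfl, hd⟩
    refine .head (Step.read r v f n c _ hv hr) ?_
    refine reflTransGen_node fun i => ?_
    obtain ⟨hlt, he⟩ := hd i
    refine ih _ ?_ he
    rw [subtree_append, hv]
    simp only [Option.bind_some, LTree.subtree, hlt, dite_true]

lemma ev_mem_trees {s : LTree ℕ} : ∀ {r : Q} {y : LTree ℕ}, T.Ev s r y → y ∈ trees G := by
  induction s with
  | node f n c ih =>
    rintro r y ⟨g, m, k, hr, d, rfl, hd⟩
    rw [mem_trees_node]
    refine ⟨(T.read_wf _ _ _ _ hr).2.1, fun i => ?_⟩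
    obtain ⟨hlt, he⟩ := hd i
    exact ih _ he

lemma ev_unique (hdet : T.Deterministic) {s : LTree ℕ} : ∀ {r : Q} {y y' : LTree ℕ},
    T.Ev s r y → T.Ev s r y' → y = y' := by
  induction s with
  | node f n c ih =>
    rintro r y y' ⟨g, m, k, hr, d, rfl, hd⟩ ⟨g', m', k', hr', d', rfl, hd'⟩
    have := hdet.2 _ _ _ hr hr'
    simp only [Term.node.injEq] at this
    obtain ⟨rfl, rfl, hk⟩ := this
    obtain rfl : k = k' := by
      funext l
      simpa using congrFun (eq_of_heq hk) l
    congr 1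
    funext l
    obtain ⟨h1, h2⟩ := hd l
    obtain ⟨h3, h4⟩ := hd' l
    exact ih _ h2 h4

lemma mem_relation_iff (hd : T.WithoutDelay) {s y : LTree ℕ} :
    (s, y) ∈ T.relation ↔ s ∈ trees S ∧ T.Ev s T.init y := by
  have hroot : s.subtree [] = some s := by cases s; rfl
  constructor
  · rintro ⟨h1, -, h2⟩
    refine ⟨h1, ?_⟩
    have : T.TermEv s (.leaf (T.init, [])) y := by
      refine Relation.ReflTransGen.head_induction_on (motive := fun ξ _ => T.TermEv s ξ y) h2
        (termEv_ofTree s y) fun h _ ih => termEv_of_step hd h _ ih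
    obtain ⟨s', hs', he⟩ := this
    rw [hroot] at hs'
    simp only [Option.some.injEq] at hs'
    rwa [hs']
  · rintro ⟨h1, h2⟩
    exact ⟨h1, ev_mem_trees h2, reflTransGen_of_ev hroot h2⟩

lemma ev_node_iff {f n : ℕ} {d : Fin n → LTree ℕ} {r : Q} {y : LTree ℕ} :
    T.Ev (.node f n d) r y ↔ ∃ (g m : ℕ) (k : Fin m → Q × ℕ),
      (Lhs.read r f n, Term.node g m fun l => .leaf (k l)) ∈ T.rules ∧
      oroot (some y) = some g ∧ oar (some y) = m ∧ ∀ l : Fin m, ∃ s' y',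
        okid (some (LTree.node f n d)) (k l).2 = some s' ∧ okid (some y) l = some y' ∧
        T.Ev s' (k l).1 y' := by
  constructor
  · rintro ⟨g, m, k, hr, e, rfl, he⟩
    refine ⟨g, m, k, hr, rfl, rfl, fun l => ?_⟩
    obtain ⟨h, hv⟩ := he l
    exact ⟨_, _, by simp [okid_node, h], okid_node_fin _ _ _ _, hv⟩
  · rintro ⟨g, m, k, hr, hg, hm, hk⟩
    obtain ⟨b, m', e⟩ := y
    simp only [oroot_node, Option.some.injEq, oar_node] at hg hm
    subst hg hm
    refine ⟨_, _, k, hr, e, rfl, fun l => ?_⟩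
    obtain ⟨s', y', h1, h2, h3⟩ := hk l
    rw [okid_node] at h1
    split_ifs at h1 with h
    simp only [okid_node_fin, Option.some.injEq] at h1 h2
    subst h1 h2
    exact ⟨h, h3⟩

end TDT

/-! ### The inputs described by a position -/

section Domain

variable (c : Ctx)

/-- The inputs described by a list of sources. -/
def DomP (P : List Src) (os : Option (LTree ℕ)) : Prop := ∃ x ∈ P, domS c x os

/-- The trees accepted by the deterministic top-down automaton whose states are lists of sources.
In general there are more of them than inputs described by the list. -/
def InB : LTree ℕ → List Src → Prop
  | .node f n d, P => Feas c P f n ∧ ∀ i : Fin n, InB (d i) (delta c P f n i)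

/-- The inputs described by `P` form a language recognized deterministically from the root down. -/
def Closed (P : List Src) : Prop := ∀ s, InB c s P → DomP c P (some s)

variable {c}

lemma mem_delta {P : List Src} {f n k : ℕ} {x : Src} :
    x ∈ delta c P f n k ↔ ∃ e ∈ exps c, ExpMatch P f n none e ∧ e.2.2.getD k none = x := by
  simp [delta, and_assoc]

lemma expMatch_none {P : List Src} {f n : ℕ} {e : Exp} :
    ExpMatch P f n none e ↔ e.1 ∈ P ∧ e.2.1 = some f ∧ e.2.2.length = n := by
  simp [ExpMatch]

lemma expMatch_some {P : List Src} {f n : ℕ} {x : Src} {e : Exp} :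
    ExpMatch P f n (some x) e ↔ e.1 = x := by
  simp [ExpMatch, eq_comm]

lemma domP_kids {P : List Src} {f n : ℕ} {d : Fin n → LTree ℕ}
    (h : DomP c P (some (.node f n d))) :
    Feas c P f n ∧ ∀ k, DomP c (delta c P f n k) (okid (some (LTree.node f n d)) k) := by
  obtain ⟨x, hx, hd⟩ := h
  obtain ⟨e, he, rfl, e2, e3, e4⟩ := exists_exp hd
  have hm : ExpMatch P f n none e := expMatch_none.2 ⟨hx, e2, e3⟩
  exact ⟨⟨e, he, hm⟩, fun k => ⟨_, mem_delta.2 ⟨e, he, hm, rfl⟩, e4 k⟩⟩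

lemma inB_of_domP {s : LTree ℕ} : ∀ {P : List Src}, DomP c P (some s) → InB c s P := by
  induction s with
  | node f n d ih =>
    intro P h
    obtain ⟨h1, h2⟩ := domP_kids h
    exact ⟨h1, fun i => ih i (by simpa using h2 i)⟩

lemma DomP.mem_trees {P : List Src} {s : LTree ℕ} (h : DomP c P (some s)) : s ∈ trees c.1 := by
  obtain ⟨x, hx, hd⟩ := h
  simpa using domS_owf hd

lemma exists_eq_node {os : Option (LTree ℕ)} {f n : ℕ} (h : oroot os = some f) (h' : oar os = n) :
    ∃ d, os = some (.node f n d) := by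
  rcases os with _ | ⟨f', n', d⟩
  · simp at h
  · simp only [oroot_node, Option.some.injEq, oar_node] at h h'
    subst h h'
    exact ⟨d, rfl⟩

lemma Feas.mem {P : List Src} {f n : ℕ} (h : Feas c P f n) : (f, n) ∈ c.1 := by
  obtain ⟨e, he, hm⟩ := h
  obtain ⟨-, h2, h3⟩ := expMatch_none.1 hm
  obtain rfl | ⟨f', q, b, -, h4, h5, -⟩ := exp_spec he
  · simp at h2
  · rw [h2, Option.some.injEq] at h4
    subst h3 h4
    exact h5

lemma Feas.exists_kids {P : List Src} {f n : ℕ} (h : Feas c P f n) :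
    ∃ u : ℕ → Option (LTree ℕ), ∀ k, DomP c (delta c P f n k) (u k) := by
  obtain ⟨e, he, hm⟩ := h
  choose u hu using exp_kid_nonempty he
  exact ⟨u, fun k => ⟨_, mem_delta.2 ⟨e, he, hm, rfl⟩, hu k⟩⟩

lemma domP_delta_isSome {P : List Src} {f n k : ℕ} {os : Option (LTree ℕ)}
    (h : DomP c (delta c P f n k) os) : os.isSome ↔ k < n := by
  obtain ⟨x, hx, hd⟩ := h
  obtain ⟨e, he, hm, rfl⟩ := mem_delta.1 hx
  rw [domS_isSome hd, exp_kid_isSome he, (expMatch_none.1 hm).2.2]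

lemma DomP.owf {P : List Src} {os : Option (LTree ℕ)} (h : DomP c P os) : OWF c.1 os := by
  obtain ⟨x, hx, hd⟩ := h
  exact domS_owf hd

lemma exists_node {f n : ℕ} (hfn : (f, n) ∈ c.1) {u : ℕ → Option (LTree ℕ)}
    (hs : ∀ k, (u k).isSome ↔ k < n) (hw : ∀ k, OWF c.1 (u k)) :
    ∃ d, LTree.node f n d ∈ trees c.1 ∧ ∀ k, okid (some (LTree.node f n d)) k = u k := by
  obtain ⟨os, h1, h2, h3, h4⟩ := exists_owf (S := c.1) (l := (some f, n)) (by simpa using hfn)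
    u hs hw
  obtain ⟨d, rfl⟩ := exists_eq_node h2 h3
  exact ⟨d, by simpa using h1, h4⟩

lemma Closed.exists_domP {P : List Src} (hP : Closed c P) {f n : ℕ} (hf : Feas c P f n)
    {u : ℕ → Option (LTree ℕ)} (hu : ∀ k, DomP c (delta c P f n k) (u k)) :
    ∃ d, DomP c P (some (.node f n d)) ∧ ∀ k, okid (some (LTree.node f n d)) k = u k := by
  obtain ⟨d, -, hd⟩ := exists_node hf.mem (fun k => domP_delta_isSome (hu k))
    fun k => (hu k).owf
  refine ⟨d, hP _ ⟨hf, fun i => inB_of_domP ?_⟩, hd⟩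
  have := hd i
  rw [okid_node_fin] at this
  rw [this]
  exact hu i

lemma Closed.delta {P : List Src} (hP : Closed c P) {f n : ℕ} (hf : Feas c P f n) {k : ℕ}
    (hk : k < n) : Closed c (delta c P f n k) := by
  intro s hs
  obtain ⟨u, hu⟩ := hf.exists_kids
  have hsome : ∀ j, (Function.update u k (some s) j).isSome ↔ j < n := by
    intro j
    by_cases hj : j = k
    · subst hj
      simp [hk]
    · simpa [hj] using domP_delta_isSome (hu j)
  obtain ⟨t, h2, h3, h4⟩ := exists_otree f n _ hsome
  obtain ⟨d, hd⟩ := exists_eq_node h2 h3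
  simp only [Option.some.injEq] at hd
  subst hd
  have hin : InB c (.node f n d) P := by
    refine ⟨hf, fun i => ?_⟩
    have hi := h4 i
    rw [okid_node_fin] at hi
    by_cases hik : (i : ℕ) = k
    · rw [hik, Function.update_self, Option.some.injEq] at hi
      rw [hi, hik]
      exact hs
    · rw [Function.update_of_ne hik] at hi
      exact inB_of_domP (hi ▸ hu i)
  have := (domP_kids (hP _ hin)).2 k
  rwa [h4, Function.update_self] at this

/-- If the inputs described by `P` are the trees that a deterministic top-down automaton accepts
from some state, then they are closed, as the subtrees of a tree can be exchanged independently
of each other. -/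
lemma closed_of_runFrom {B : TopDownTA ℕ} (hB : B.Deterministic) {P : List Src} {p : ℕ}
    (h : ∀ s, DomP c P (some s) ↔ s ∈ trees c.1 ∧ B.RunFrom p s) : Closed c P := by
  intro s
  induction s generalizing P p with
  | node f n d ih =>
    rintro ⟨hf, hk⟩
    obtain ⟨e, he, hm⟩ := id hf
    obtain ⟨hm1, hm2, hm3⟩ := expMatch_none.1 hm
    -- Valid trees arise from subtrees that are described by one and the same expansion.
    have build : ∀ e ∈ exps c, ExpMatch P f n none e → ∀ u : ℕ → Option (LTree ℕ),
        (∀ k, domS c (e.2.2.getD k none) (u k)) → ∃ d', DomP c P (some (.node f n d')) ∧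
          ∀ k, okid (some (LTree.node f n d')) k = u k := by
      intro e he hm u hu
      obtain ⟨hm1, hm2, hm3⟩ := expMatch_none.1 hm
      obtain ⟨os, h1, h2, h3, h4⟩ := exists_domS_of_exp he u hu
      obtain ⟨d', rfl⟩ := exists_eq_node (h2.trans hm2) (h3.trans hm3)
      exact ⟨d', ⟨_, hm1, h1⟩, h4⟩
    choose u hu using exp_kid_nonempty he
    obtain ⟨d', hd', -⟩ := build e he hm u hu
    obtain ⟨htr, p', hp', hrun⟩ := (h _).1 hd'
    rw [mem_trees_node] at htr
    have hkid : ∀ (k : Fin n) (s : LTree ℕ), DomP c (TreeUnif.delta c P f n k) (some s) ↔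
        s ∈ trees c.1 ∧ B.RunFrom (p' k) s := by
      intro k s
      constructor
      · intro hs
        refine ⟨hs.mem_trees, ?_⟩
        obtain ⟨x, hx, hxs⟩ := hs
        obtain ⟨e', he', hm', rfl⟩ := mem_delta.1 hx
        choose u' hu' using exp_kid_nonempty he'
        obtain ⟨d2, hd2, hd3⟩ := build e' he' hm' (Function.update u' k (some s)) fun j => by
          by_cases hj : j = k
          · subst hj
            simpa using hxs
          · simpa [hj] using hu' j
        obtain ⟨-, p2, hp2, hrun2⟩ := (h _).1 hd2
        have : p2 = p' := List.ofFn_injective (hB.2 _ _ _ _ hp2 hp' (by simp))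
        subst this
        have := hd3 k
        simp only [okid_node_fin, Function.update_self, Option.some.injEq] at this
        rw [← this]
        exact hrun2 k
      · rintro ⟨hs, hr⟩
        have : DomP c P (some (.node f n (Function.update d' k s))) := by
          refine (h _).2 ⟨mem_trees_node.2 ⟨htr.1, fun i => ?_⟩, p', hp', fun i => ?_⟩
          · by_cases hi : i = k
            · subst hi
              simpa using hs
            · simpa [hi] using htr.2 i
          · by_cases hi : i = k
            · subst hi
              simpa using hr
            · simpa [hi] using hrun i
        have := (domP_kids this).2 k
        simpa using this
    have hd : ∀ i, d i ∈ trees c.1 ∧ B.RunFrom (p' i) (d i) := fun i =>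
      (hkid i _).1 (ih i (hkid i) (hk i))
    exact (h _).2 ⟨mem_trees_node.2 ⟨htr.1, fun i => (hd i).1⟩, p', hp', fun i => (hd i).2⟩

end Domain

/-! ### A uniformizer does not lose the game -/

section Completeness

variable {c : Ctx} {Q : Type} {T : TDT c.1 c.2.1 Q}

variable (c) in
/-- The output `ot` produced from the input `os` satisfies the requirement. -/
def ItemSat (it : Item) (os ot : Option (LTree ℕ)) : Prop :=
  match it.2 with
  | none => OAcc c.2.2 it.1 os ot
  | some x => ∀ os', domS c x os' → OAcc c.2.2 it.1 os' ot

/-- From the state `r`, the transducer fulfils the task on all inputs described by `P`. -/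
def Fulfils (T : TDT c.1 c.2.1 Q) (P : List Src) (r : Q) (S : Task) : Prop :=
  ∀ s, DomP c P (some s) → ∃ t, T.Ev s r t ∧ ∀ it ∈ S, ItemSat c it (some s) (some t)

/-- The option taken in the state `r` is valid, and the states below it fulfil the next tasks. -/
lemma Fulfils.exists_option (hA : c.2.2.Deterministic) (hT : T.Deterministic) {P : List Src}
    (hP : Closed c P) {f n : ℕ} (hf : Feas c P f n) {r : Q} {S : Task} (h : Fulfils T P r S) :
    ∃ (o : Opt) (ρ : ℕ → Q), o ∈ opts c n ∧ Valid c P f n S o ∧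
      (∀ k i, o.2[i]? = some k → Fulfils T (delta c P f n k) (ρ i) (nextTask c P f n S o i)) ∧
      ∀ d : Fin n → LTree ℕ, (∀ k i, o.2[i]? = some k → ∃ s t,
        okid (some (LTree.node f n d)) k = some s ∧ T.Ev s (ρ i) t) →
          ∃ t, T.Ev (.node f n d) r t := by
  obtain ⟨w, hw⟩ := hf.exists_kids
  obtain ⟨d₀, hd₀, hdw⟩ := hP.exists_domP hf hw
  obtain ⟨y₀, hy₀, hsat₀⟩ := h _ hd₀
  obtain ⟨g, m, κ, hrule, hg₀, hm₀, -⟩ := TDT.ev_node_iff.1 hy₀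
  -- All inputs with this letter at the root are processed by the same rule.
  have value : ∀ d y, T.Ev (.node f n d) r y → oroot (some y) = some g ∧ oar (some y) = m ∧
      ∀ l : Fin m, ∃ s' y', okid (some (LTree.node f n d)) (κ l).2 = some s' ∧
        okid (some y) l = some y' ∧ T.Ev s' (κ l).1 y' := by
    intro d y hy
    obtain ⟨g', m', κ', hr', h1, h2, h3⟩ := TDT.ev_node_iff.1 hy
    have := hT.2 _ _ _ hrule hr'
    simp only [Term.node.injEq] at this
    obtain ⟨rfl, rfl, hk⟩ := this
    obtain rfl : κ = κ' := by
      funext l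
      simpa using congrFun (eq_of_heq hk) l
    exact ⟨h1, h2, h3⟩
  -- Transitions for items that are in step with the input
  have sync : ∀ q, (q, none) ∈ S → ∀ d y, DomP c P (some (.node f n d)) →
      T.Ev (.node f n d) r y → ∃ tr ∈ c.trans, TrMatch tr q (some f) (some g) (max n m) ∧
        ∀ k < max n m, OAcc c.2.2 (tr.2.2.getD k 0) (okid (some (LTree.node f n d)) k)
          (okid (some y) k) := by
    intro q hq d y hd hy
    obtain ⟨y', hy', hs⟩ := h _ hd
    obtain rfl := TDT.ev_unique hT hy hy'
    obtain ⟨v1, v2, -⟩ := value d y hy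
    have hacc : OAcc c.2.2 q (some (.node f n d)) (some y) := hs _ hq
    rw [oacc_iff (by simp), v1, v2] at hacc
    exact hacc
  -- Transitions for the other items
  have div : ∀ q x, (q, some x) ∈ S → ∀ d y, DomP c P (some (.node f n d)) →
      T.Ev (.node f n d) r y → ∀ e ∈ exps c, e.1 = x → ∃ tr ∈ c.trans,
        TrMatch tr q e.2.1 (some g) (max e.2.2.length m) ∧
        ∀ k < max e.2.2.length m, ∀ os, domS c (e.2.2.getD k none) os →
          OAcc c.2.2 (tr.2.2.getD k 0) os (okid (some y) k) := by
    intro q x hq d y hd hy e he hex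
    obtain ⟨y', hy', hs⟩ := h _ hd
    obtain rfl := TDT.ev_unique hT hy hy'
    obtain ⟨v1, v2, -⟩ := value d y hy
    have hacc : ∀ os, domS c x os → OAcc c.2.2 q os (some y) := hs _ hq
    have := (forall_domS_oacc_iff hA (by simp)).1 hacc e he hex
    rwa [v1, v2] at this
  have kidsome : ∀ l : Fin m, (κ l).2 < n := (T.read_wf _ _ _ _ hrule).2.2
  have hdir : ∀ k i, (List.ofFn fun l => (κ l).2)[i]? = some k →
      ∃ hi : i < m, (κ ⟨i, hi⟩).2 = k := by
    intro k i hki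
    obtain ⟨hi, he⟩ := List.getElem?_eq_some_iff.1 hki
    simp only [List.length_ofFn] at hi
    exact ⟨hi, by simpa using he⟩
  refine ⟨(g, List.ofFn fun l => (κ l).2), fun i => if hi : i < m then (κ ⟨i, hi⟩).1 else r,
    ?_, ?_, ?_, ?_⟩
  · rw [mem_opts]
    refine ⟨by simpa [RankedAlphabet.HasRank] using (T.read_wf _ _ _ _ hrule).2.1, fun d hd => ?_⟩
    obtain ⟨l, rfl⟩ := (List.mem_ofFn' _ _).1 hd
    exact kidsome l
  · rintro ⟨q, x⟩ hit e he hme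
    simp only [List.length_ofFn]
    have hnone : ∀ k, m ≤ k → ∀ y : LTree ℕ, oar (some y) = m → okid (some y) k = none := fun k hk y hy =>
      okid_eq_none (by omega)
    rcases x with _ | x
    · obtain ⟨hm1, hm2, hm3⟩ := expMatch_none.1 hme
      obtain ⟨tr, htr, hm, -⟩ := sync q hit d₀ y₀ hd₀ hy₀
      rw [hm2, hm3]
      refine ⟨tr, htr, hm, fun k hk hmk => ?_⟩
      have hkn : k < n := by omega
      refine (mem_padList hA (getD_mem_succStates htr (by rw [hm.2.2]; exact hk))
        (getD_mem_srcList he k) ((exp_kid_isSome he k).2 (by omega))).2 fun os hos => ?_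
      choose u hu using exp_kid_nonempty he
      obtain ⟨d, hd, hdk⟩ := hP.exists_domP hf (u := Function.update u k os) fun j =>
        ⟨_, mem_delta.2 ⟨e, he, hme, rfl⟩, by
          by_cases hj : j = k
          · subst hj
            simpa using hos
          · simpa [hj] using hu j⟩
      obtain ⟨y, hy, -⟩ := h _ hd
      obtain ⟨tr', htr', hm', hacc⟩ := sync q hit d y hd hy
      obtain rfl := trMatch_unique hA htr htr' hm hm'
      have := hacc k hk
      rwa [hdk, Function.update_self, hnone k hmk y (value d y hy).2.1] at this
    · obtain ⟨tr, htr, hm, hacc⟩ := div q x hit d₀ y₀ hd₀ hy₀ e he (expMatch_some.1 hme)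
      refine ⟨tr, htr, hm, fun k hk hmk => ?_⟩
      refine (mem_padList hA (getD_mem_succStates htr (by rw [hm.2.2]; exact hk))
        (getD_mem_srcList he k) ((exp_kid_isSome he k).2 (by omega))).2 fun os hos => ?_
      have := hacc k hk os hos
      rwa [hnone k hmk y₀ hm₀] at this
  · intro k i hki s hs
    obtain ⟨hi, rfl⟩ := hdir k i hki
    set k := (κ ⟨i, hi⟩).2 with hk
    -- A valid input with prescribed subtrees has an output whose `i`-th subtree depends on `s` only.
    have extend : ∀ u : ℕ → Option (LTree ℕ), (∀ j, DomP c (delta c P f n j) (u j)) →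
        u k = some s → ∃ d y t, DomP c P (some (.node f n d)) ∧ T.Ev (.node f n d) r y ∧
          (∀ j, okid (some (LTree.node f n d)) j = u j) ∧ okid (some y) i = some t ∧
          T.Ev s (κ ⟨i, hi⟩).1 t := by
      intro u hu huk
      obtain ⟨d, hd, hdu⟩ := hP.exists_domP hf hu
      obtain ⟨y, hy, -⟩ := h _ hd
      obtain ⟨s', t, h1, h2, h3⟩ := (value d y hy).2.2 ⟨i, hi⟩
      rw [hdu, ← hk, huk, Option.some.injEq] at h1
      subst h1
      exact ⟨d, y, t, hd, hy, hdu, h2, h3⟩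
    have hws : ∀ j, DomP c (delta c P f n j) (Function.update w k (some s) j) := fun j => by
      by_cases hj : j = k
      · subst hj
        simpa using hs
      · simpa [hj] using hw j
    obtain ⟨d₁, y₁, t, hd₁, hy₁, hdu₁, hyt₁, ht⟩ := extend _ hws (by simp)
    simp only [hi, dite_true]
    refine ⟨t, ht, fun it hit => ?_⟩
    obtain ⟨-, ⟨q, x⟩, hqx, e, he, hme, tr, htr, hm, rfl⟩ := mem_nextTask.1 hit
    simp only [List.length_ofFn] at hm
    rcases x with _ | x
    · obtain ⟨hm1, hm2, hm3⟩ := expMatch_none.1 hme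
      rw [hm2, hm3] at hm
      have him : i < max n m := lt_max_of_lt_right hi
      simp only [kidSrc, true_and, hki, Option.some.injEq]
      by_cases hki' : k = i
      · rw [if_pos hki']
        obtain ⟨tr', htr', hm', hacc⟩ := sync q hqx d₁ y₁ hd₁ hy₁
        obtain rfl := trMatch_unique hA htr htr' hm hm'
        have := hacc i him
        rw [hdu₁, hyt₁, ← hki', Function.update_self] at this
        rw [← hki']
        exact this
      · rw [if_neg hki']
        intro os' hos'
        obtain ⟨d₂, y₂, t', hd₂, hy₂, hdu₂, hyt₂, ht'⟩ :=
          extend (Function.update (Function.update w k (some s)) i os') (fun j => by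
            by_cases hj : j = i
            · subst hj
              rw [Function.update_self]
              exact ⟨_, mem_delta.2 ⟨e, he, hme, rfl⟩, hos'⟩
            · rw [Function.update_of_ne hj]
              exact hws j) (by rw [Function.update_of_ne hki', Function.update_self])
        obtain rfl := TDT.ev_unique hT ht ht'
        obtain ⟨tr', htr', hm', hacc⟩ := sync q hqx d₂ y₂ hd₂ hy₂
        obtain rfl := trMatch_unique hA htr htr' hm hm'
        have := hacc i him
        rwa [hdu₂, hyt₂, Function.update_self] at this
    · obtain ⟨tr', htr', hm', hacc⟩ := div q x hqx d₁ y₁ hd₁ hy₁ e he (expMatch_some.1 hme)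
      obtain rfl := trMatch_unique hA htr htr' hm hm'
      simp only [kidSrc, reduceCtorEq, false_and, if_false]
      intro os' hos'
      have := hacc i (lt_max_of_lt_right hi) os' hos'
      rwa [hyt₁] at this
  · intro d hd
    have : ∀ l : Fin m, ∃ s t, okid (some (LTree.node f n d)) (κ l).2 = some s ∧
        T.Ev s (κ l).1 t := by
      intro l
      obtain ⟨s, t, h1, h2⟩ := hd (κ l).2 l (by simp)
      simp only [l.2, dite_true] at h2
      exact ⟨s, t, h1, h2⟩
    choose s t h1 h2 using this
    exact ⟨.node g m t, TDT.ev_node_iff.2 ⟨g, m, κ, hrule, rfl, rfl, fun l =>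
      ⟨s l, t l, h1 l, by simp, h2 l⟩⟩⟩

lemma exists_list_of_forall₂ {α β γ : Type} {R : α → β → Prop} {R' : α → β → γ → Prop}
    (h : ∀ a b, R a b → ∃ w, R' a b w) {l : List α} {l' : List β} (hl : List.Forall₂ R l l') :
    ∃ y : List (α × β × γ), y.map (fun e => e.1) = l ∧ y.map (fun e => e.2.1) = l' ∧
      ∀ e ∈ y, R' e.1 e.2.1 e.2.2 := by
  induction hl with
  | nil => exact ⟨[], by simp⟩
  | @cons a b _ _ hr _ ih =>
    obtain ⟨y, h1, h2, h3⟩ := ih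
    obtain ⟨w, hw⟩ := h _ _ hr
    refine ⟨(a, b, w) :: y, by simp [h1], by simp [h2], fun e he => ?_⟩
    rcases List.mem_cons.1 he with rfl | he
    · exact hw
    · exact h3 e he

lemma forall₂_flatMap {α β γ : Type} {R : β → γ → Prop} {g : α → List β} {h : α → List γ}
    {y : List α} (hy : ∀ e ∈ y, List.Forall₂ R (g e) (h e)) :
    List.Forall₂ R (y.flatMap g) (y.flatMap h) := by
  induction y with
  | nil => simp
  | cons a y ih =>
    rw [List.flatMap_cons, List.flatMap_cons]
    exact List.rel_append (hy a List.mem_cons_self)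
      (ih fun e he => hy e (List.mem_cons_of_mem _ he))

/-- If copies of a transducer fulfil their tasks and jointly reject all inputs that are not
described by `P`, the position is not lost. -/
lemma not_lose_of_fulfils (hA : c.2.2.Deterministic) (hT : T.Deterministic) {P : List Src}
    {τ : List Task} (hP : Closed c P) (hne : τ ≠ [] ∨ ∃ s, DomP c P (some s)) {rs : List Q}
    (hrs : List.Forall₂ (Fulfils T P) rs τ)
    (hval : ∀ s ∈ trees c.1, (∀ r ∈ rs, ∃ t, T.Ev s r t) → DomP c P (some s)) :
    ¬ Lose c P τ := by
  let W : Set Pos := {p | Closed c p.1 ∧ (p.2 ≠ [] ∨ ∃ s, DomP c p.1 (some s)) ∧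
    ∃ rs : List Q, List.Forall₂ (Fulfils T p.1) rs p.2 ∧
      ∀ s ∈ trees c.1, (∀ r ∈ rs, ∃ t, T.Ev s r t) → DomP c p.1 (some s)}
  refine not_lose_of_closed (W := W) (p := (P, τ)) ?_ ⟨hP, hne, rs, hrs, hval⟩
  clear! P τ rs
  rintro ⟨P, τ⟩ ⟨hP, hne, rs, hrs, hval⟩ f n hfn
  simp only at hP hne hrs hval ⊢
  constructor
  · intro hf
    obtain ⟨y, rfl, rfl, hy⟩ := exists_list_of_forall₂
      (R' := fun r S (w : Opt × (ℕ → Q)) => w.1 ∈ opts c n ∧ Valid c P f n S w.1 ∧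
        (∀ k i, w.1.2[i]? = some k →
          Fulfils T (delta c P f n k) (w.2 i) (nextTask c P f n S w.1 i)) ∧
        ∀ d : Fin n → LTree ℕ, (∀ k i, w.1.2[i]? = some k → ∃ s t,
          okid (some (LTree.node f n d)) k = some s ∧ T.Ev s (w.2 i) t) →
            ∃ t, T.Ev (.node f n d) r t)
      (fun r S hrS => by
        obtain ⟨o, ρ, ho⟩ := hrS.exists_option hA hT hP hf
        exact ⟨(o, ρ), ho⟩) hrs
    obtain ⟨w, hw⟩ := hf.exists_kids
    refine ⟨y.map fun e => (e.2.1, e.2.2.1), ?_, fun k hk => ⟨hP.delta hf hk, .inr ?_,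
      y.flatMap fun e => ((List.range e.2.2.1.2.length).filter
        fun i => e.2.2.1.2[i]? = some k).map e.2.2.2, ?_, ?_⟩⟩
    · rw [mem_sec_moves, List.forall₂_map_left_iff, List.forall₂_map_right_iff, List.forall₂_same]
      exact fun e he => mem_moves.2 ⟨rfl, (hy e he).1, (hy e he).2.1⟩
    · have := (domP_delta_isSome (hw k)).2 hk
      obtain ⟨s, hs⟩ := Option.isSome_iff_exists.1 this
      exact ⟨s, hs ▸ hw k⟩
    · simp only [nextTasks, List.flatMap_map]
      refine forall₂_flatMap fun e he => ?_
      rw [List.forall₂_map_left_iff, List.forall₂_map_right_iff, List.forall₂_same]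
      intro i hi
      exact (hy e he).2.2.1 k i (by simpa using (List.mem_filter.1 hi).2)
    · intro s hs hall
      obtain ⟨d, hdt, hd⟩ := exists_node hfn (u := Function.update w k (some s))
        (fun j => by
          by_cases hj : j = k
          · subst hj
            simp [hk]
          · simpa [hj] using domP_delta_isSome (hw j))
        (fun j => by
          by_cases hj : j = k
          · subst hj
            simpa using hs
          · simpa [hj] using (hw j).owf)
      have hdom : DomP c P (some (.node f n d)) := by
        refine hval _ hdt fun r hr => ?_
        obtain ⟨e, he, rfl⟩ := List.mem_map.1 hr
        refine (hy e he).2.2.2 d fun k' i hi => ?_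
        rw [hd]
        by_cases hkk : k' = k
        · subst hkk
          rw [Function.update_self]
          obtain ⟨t, ht⟩ := hall (e.2.2.2 i) (List.mem_flatMap.2 ⟨e, he, List.mem_map.2 ⟨i,
            List.mem_filter.2 ⟨List.mem_range.2 (List.getElem?_eq_some_iff.1 hi).1,
              by simpa using hi⟩, rfl⟩⟩)
          exact ⟨s, t, rfl, ht⟩
        · rw [Function.update_of_ne hkk]
          have hk'n : k' < n :=
            (mem_opts.1 (hy e he).1).2 k' (List.mem_of_getElem? hi)
          obtain ⟨s', hs'⟩ := Option.isSome_iff_exists.1 ((domP_delta_isSome (hw k')).2 hk'n)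
          obtain ⟨t, ht, -⟩ := (hy e he).2.2.1 k' i hi s' (hs' ▸ hw k')
          exact ⟨s', t, hs', ht⟩
      have := (domP_kids hdom).2 k
      rwa [hd, Function.update_self] at this
  · rintro hf rfl
    obtain ⟨s₀, hs₀⟩ := hne.resolve_left (by simp)
    cases hrs
    have : DomP c P (some (.node f n fun _ => s₀)) :=
      hval _ (mem_trees_node.2 ⟨hfn, fun _ => hs₀.mem_trees⟩) (by simp)
    exact hf (domP_kids this).1

end Completeness

/-! ### A transducer from a finite set of safe positions -/

section Soundness

/-- If a list arises from `l.map F` by dropping entries, but still contains all entries up to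
repetition, then the members of `l` can be sent onto its positions in accordance with `F`. -/
lemma exists_index_map {κ β : Type} {l : List κ} (hl : l.Nodup) {F : κ → β} {τ : List β}
    (hs : τ.Sublist (l.map F)) (hsub : ∀ S ∈ l.map F, S ∈ τ) :
    ∃ t : κ → ℕ, (∀ x ∈ l, τ[t x]? = some (F x)) ∧ ∀ b < τ.length, ∃ x ∈ l, t x = b := by
  classical
  obtain ⟨l', hl', rfl⟩ := List.sublist_map_iff.1 hs
  refine ⟨fun x => if x ∈ l' then l'.idxOf x else (l'.map F).idxOf (F x), fun x hx => ?_,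
    fun b hb => ?_⟩
  · by_cases hx' : x ∈ l'
    · simp [hx', List.getElem?_idxOf hx']
    · simp only [hx', if_false]
      exact List.getElem?_idxOf (hsub _ (List.mem_map_of_mem hx))
  · rw [List.length_map] at hb
    refine ⟨l'[b], hl'.subset (List.getElem_mem _), ?_⟩
    simp only [List.getElem_mem, if_true]
    exact (hl.sublist hl').idxOf_getElem b hb

variable {c : Ctx} {W : List Pos}

lemma exists_index_map_nextTasks {P : List Src} {f n k : ℕ} {z : List (Task × Opt)}
    {τ : List Task} (hs : τ.Sublist (nextTasks c P f n k z))
    (hsub : ∀ S ∈ nextTasks c P f n k z, S ∈ τ) :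
    ∃ t : ℕ → ℕ → ℕ,
      (∀ a < z.length, ∀ i, (z.getD a default).2.2[i]? = some k → τ[t a i]? =
        some (nextTask c P f n (z.getD a default).1 (z.getD a default).2 i)) ∧
      ∀ b < τ.length, ∃ a < z.length, ∃ i, (z.getD a default).2.2[i]? = some k ∧ t a i = b := by
  let kids : List (ℕ × ℕ) := (List.range z.length).flatMap fun a =>
    ((List.range (z.getD a default).2.2.length).filter
      fun i => (z.getD a default).2.2[i]? = some k).map fun i => (a, i)
  have hmem : ∀ a i, (a, i) ∈ kids ↔ a < z.length ∧ (z.getD a default).2.2[i]? = some k := by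
    intro a i
    simp only [kids, List.mem_flatMap, List.mem_range, List.mem_map, List.mem_filter,
      decide_eq_true_eq, Prod.mk.injEq]
    constructor
    · rintro ⟨a, ha, i, hi, rfl, rfl⟩
      exact ⟨ha, hi.2⟩
    · rintro ⟨ha, hi⟩
      exact ⟨a, ha, i, ⟨(List.getElem?_eq_some_iff.1 hi).1, hi⟩, rfl, rfl⟩
  have hnodup : kids.Nodup := by
    refine List.nodup_flatMap.2 ⟨fun a _ => ?_, ?_⟩
    · exact (List.nodup_range.filter _).map fun i j h => by simpa using h
    · refine List.nodup_range.imp fun {a b} hab => ?_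
      simp only [Function.onFun, List.disjoint_left, List.mem_map]
      rintro x ⟨i, -, rfl⟩ ⟨j, -, h⟩
      exact hab (by simpa using (congrArg Prod.fst h).symm)
  have hz : z = (List.range z.length).map fun a => z.getD a default := by
    refine List.ext_getElem (by simp) fun i h1 h2 => ?_
    simp [List.getD, h1]
  have heq : nextTasks c P f n k z = kids.map fun x =>
      nextTask c P f n (z.getD x.1 default).1 (z.getD x.1 default).2 x.2 := by
    conv_lhs => rw [hz]
    simp only [nextTasks, kids, List.flatMap_map, List.map_flatMap, List.map_map]
    rfl
  rw [heq] at hs hsub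
  obtain ⟨t, h1, h2⟩ := exists_index_map hnodup hs hsub
  refine ⟨fun a i => t (a, i), fun a ha i hi => h1 (a, i) ((hmem a i).2 ⟨ha, hi⟩),
    fun b hb => ?_⟩
  obtain ⟨⟨a, i⟩, hx, hb'⟩ := h2 b hb
  exact ⟨a, ((hmem a i).1 hx).1, i, ((hmem a i).1 hx).2, hb'⟩

/-- The moves at a safe position: each copy `a` takes a valid option, its successors become copies
in safe positions, and each copy there arises in this way. -/
lemma YesCert.exists_moves (hW : YesCert c W) {p : Pos} (hp : p ∈ W) {f n : ℕ}
    (hf : Feas c p.1 f n) : ∃ (o : ℕ → Opt) (t : ℕ → ℕ → Pos × ℕ),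
      (∀ a < p.2.length, o a ∈ opts c n ∧ Valid c p.1 f n (p.2.getD a []) (o a) ∧
        ∀ i k, (o a).2[i]? = some k → (t a i).1 ∈ W ∧ (t a i).1.1 = delta c p.1 f n k ∧
          (t a i).1.2[(t a i).2]? = some (nextTask c p.1 f n (p.2.getD a []) (o a) i)) ∧
      ∀ k < n, ∃ p' ∈ W, p'.1 = delta c p.1 f n k ∧ ∀ b < p'.2.length,
        ∃ a < p.2.length, ∃ i, (o a).2[i]? = some k ∧ t a i = (p', b) := by
  obtain ⟨-, z, hz, hk⟩ := (hW p hp (f, n) hf.mem).resolve_right fun h => h.1 hf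
  simp only at hz hk
  rw [mem_sec_moves] at hz
  have hlen := hz.length_eq
  have hmv : ∀ a < p.2.length, (z.getD a default).1 = p.2.getD a [] ∧
      (z.getD a default).2 ∈ opts c n ∧
      Valid c p.1 f n (p.2.getD a []) (z.getD a default).2 := by
    intro a ha
    have hza : a < z.length := by omega
    have := mem_moves.1 (hz.get hza ha)
    simpa [List.getD, ha, hza] using this
  choose! p' hp' hd hpw hsub using hk
  have := fun k (hkn : k < n) => exists_index_map_nextTasks (mem_pw.1 (hpw k hkn)) (hsub k hkn)
  choose! t ht1 ht2 using this
  have hdir : ∀ a < p.2.length, ∀ i k, (z.getD a default).2.2[i]? = some k → k < n :=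
    fun a ha i k hi => (mem_opts.1 (hmv a ha).2.1).2 k (List.mem_of_getElem? hi)
  refine ⟨fun a => (z.getD a default).2, fun a i =>
    let k := (z.getD a default).2.2.getD i 0
    (p' k, t k a i), fun a ha => ⟨(hmv a ha).2.1, (hmv a ha).2.2, fun i k hi => ?_⟩,
    fun k hkn => ⟨p' k, hp' k hkn, hd k hkn, fun b hb => ?_⟩⟩
  · have hkn := hdir a ha i k hi
    have hgd : (z.getD a default).2.2.getD i 0 = k := by
      rw [List.getD_eq_getElem?_getD, show (z.getD a default).2.2[i]? = some k from hi]
      rfl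
    simp only [hgd]
    refine ⟨hp' k hkn, hd k hkn, ?_⟩
    rw [ht1 k hkn a (by omega) i hi, (hmv a ha).1]
  · obtain ⟨a, ha, i, hi, htb⟩ := ht2 k hkn b hb
    have hgd : (z.getD a default).2.2.getD i 0 = k := by
      rw [List.getD_eq_getElem?_getD, show (z.getD a default).2.2[i]? = some k from hi]
      rfl
    exact ⟨a, by omega, i, hi, by simp only [hgd, htb]⟩

/-- The copies in the positions of `W`. -/
def copies (W : List Pos) : List (Pos × ℕ) :=
  W.flatMap fun p => (List.range p.2.length).map fun a => (p, a)

lemma mem_copies {x : Pos × ℕ} : x ∈ copies W ↔ x.1 ∈ W ∧ x.2 < x.1.2.length := by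
  obtain ⟨p, a⟩ := x
  simp only [copies, List.mem_flatMap, List.mem_map, List.mem_range, Prod.mk.injEq]
  constructor
  · rintro ⟨p, hp, a, ha, rfl, rfl⟩
    exact ⟨hp, ha⟩
  · rintro ⟨hp, ha⟩
    exact ⟨p, hp, a, ha, rfl, rfl⟩

/-- The outputs of a copy satisfy its items, if the outputs of its successors do. -/
lemma itemSat_of_kids (hA : c.2.2.Deterministic) {P : List Src} {f n : ℕ} {S : Task} {o : Opt}
    (hv : Valid c P f n S o) {d : Fin n → LTree ℕ} (hd : DomP c P (some (.node f n d)))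
    {y : LTree ℕ} (hy : oroot (some y) = some o.1) (hy' : oar (some y) = o.2.length)
    (hk : ∀ i k, o.2[i]? = some k → ∀ it ∈ nextTask c P f n S o i,
      ItemSat c it (okid (some (LTree.node f n d)) k) (okid (some y) i)) :
    ∀ it ∈ S, ItemSat c it (some (.node f n d)) (some y) := by
  rintro ⟨q, x⟩ hit
  have key : ∀ os, ∀ e ∈ exps c, ExpMatch P f n x e → e.2.1 = oroot os → e.2.2.length = oar os →
      (∀ k, domS c (e.2.2.getD k none) (okid os k)) → (x = none → os = some (.node f n d)) →
      OAcc c.2.2 q os (some y) := by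
    intro os e he hm h1 h2 h3 hos
    obtain ⟨tr, htr, htm, hpad⟩ := hv (q, x) hit e he hm
    rw [oacc_iff (by simp), hy, hy', ← h1, ← h2]
    refine ⟨tr, htr, htm, fun k hkl => ?_⟩
    have hsucc := getD_mem_succStates htr (by rw [htm.2.2]; exact hkl)
    by_cases hkm : k < o.2.length
    · have hget : o.2[k]? = some o.2[k] := List.getElem?_eq_getElem hkm
      have hmem : (tr.2.2.getD k 0, kidSrc x o.2 e k) ∈ nextTask c P f n S o k := by
        refine mem_nextTask.2 ⟨List.mem_product.2 ⟨hsucc, ?_⟩, (q, x), hit, e, he, hm, tr, htr,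
          htm, rfl⟩
        simp only [kidSrc]
        split_ifs
        · exact List.mem_cons_self
        · exact List.mem_cons_of_mem _ (List.mem_map_of_mem (getD_mem_srcList he k))
      have hsat := hk k _ hget _ hmem
      simp only [ItemSat, kidSrc] at hsat
      by_cases hc : x = none ∧ o.2[k]? = some k
      · have hkk : o.2[k] = k := by
          have := hc.2
          rw [hget] at this
          simpa using this
        rw [if_pos hc, hkk, ← hos hc.1] at hsat
        exact hsat
      · rw [if_neg hc] at hsat
        exact hsat _ (h3 k)
    · have hmk : o.2.length ≤ k := not_lt.1 hkm
      rw [okid_eq_none (os := some y) (by omega)]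
      exact (mem_padList hA hsucc (getD_mem_srcList he k)
        ((exp_kid_isSome he k).2 (by omega))).1 (hpad k hkl hmk) _ (h3 k)
  rcases x with _ | x
  · obtain ⟨x', hx', hd'⟩ := hd
    obtain ⟨e, he, rfl, e2, e3, e4⟩ := exists_exp hd'
    exact key _ e he (expMatch_none.2 ⟨hx', e2, e3⟩) e2 e3 e4 fun _ => rfl
  · intro os hos
    obtain ⟨e, he, e1, e2, e3, e4⟩ := exists_exp hos
    exact key _ e he (expMatch_some.2 e1) e2 e3 e4 fun h => by simp at h

/-- The transducer has the copies in the positions of `W` as states, and follows the moves that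
keep the game within `W`. -/
theorem YesCert.exists_transducer (hA : c.2.2.Deterministic) (hW : YesCert c W)
    {P₀ : List Src} {S₀ : Task} (h₀ : (P₀, [S₀]) ∈ W) :
    ∃ (Q : Type) (_ : Finite Q) (T : TDT c.1 c.2.1 Q), T.Deterministic ∧ T.WithoutDelay ∧
      Fulfils T P₀ T.init S₀ ∧
      ∀ s ∈ trees c.1, (∃ t, T.Ev s T.init t) → InB c s P₀ := by
  classical
  have hmoves := fun p (hp : p ∈ W) f n (hf : Feas c p.1 f n) => hW.exists_moves hp hf
  choose! o t h1 h2 using hmoves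
  let Q : Type := {x // x ∈ copies W}
  have hQ : Finite Q := (copies W).finite_toSet
  have hi : ((P₀, [S₀]), 0) ∈ copies W := mem_copies.2 ⟨h₀, by simp⟩
  let emb : Pos × ℕ → Q := fun y => if h : y ∈ copies W then ⟨y, h⟩ else ⟨_, hi⟩
  have hemb : ∀ {y} (h : y ∈ copies W), emb y = ⟨y, h⟩ := fun h => by simp [emb, h]
  let rhs : Pos × ℕ → ℕ → ℕ → Term ℕ (Q × ℕ) := fun x f n =>
    .node (o x.1 f n x.2).1 (o x.1 f n x.2).2.length fun l =>
      .leaf (emb (t x.1 f n x.2 l), (o x.1 f n x.2).2[l])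
  let rules : Set (Lhs Q × Term ℕ (Q × ℕ)) :=
    {r | ∃ (x : Q) (f n : ℕ), (f, n) ∈ c.1 ∧ Feas c x.1.1.1 f n ∧
      r = (Lhs.read x f n, rhs x.1 f n)}
  let T : TDT c.1 c.2.1 Q :=
    { init := ⟨_, hi⟩
      rules := rules
      finite_rules := by
        refine ((Set.finite_univ (α := Q)).prod c.1.finite_toSet |>.image
          fun x => (Lhs.read x.1 x.2.1 x.2.2, rhs x.1.1 x.2.1 x.2.2)).subset ?_
        rintro _ ⟨x, f, n, hfn, -, rfl⟩
        exact ⟨(x, (f, n)), ⟨trivial, hfn⟩, rfl⟩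
      read_wf := by
        rintro q f n w ⟨x, f', n', hfn, hf, he⟩
        simp only [Prod.mk.injEq, Lhs.read.injEq] at he
        obtain ⟨⟨rfl, rfl, rfl⟩, rfl⟩ := he
        obtain ⟨hx1, hx2⟩ := mem_copies.1 q.2
        have ho := mem_opts.1 (h1 _ hx1 _ _ hf _ hx2).1
        exact ⟨hfn, ho.1, fun l => ho.2 _ (List.getElem_mem _)⟩
      eps_wf := by
        rintro q w ⟨x, f', n', hfn, hf, he⟩
        simp at he }
  have hrule : ∀ (x : Q) f n w, (Lhs.read x f n, w) ∈ T.rules ↔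
      (f, n) ∈ c.1 ∧ Feas c x.1.1.1 f n ∧ w = rhs x.1 f n := by
    intro x f n w
    constructor
    · rintro ⟨x', f', n', hfn, hf, he⟩
      simp only [Prod.mk.injEq, Lhs.read.injEq] at he
      obtain ⟨⟨rfl, rfl, rfl⟩, rfl⟩ := he
      exact ⟨hfn, hf, rfl⟩
    · rintro ⟨hfn, hf, rfl⟩
      exact ⟨x, f, n, hfn, hf, rfl⟩
  refine ⟨Q, hQ, T, ⟨?_, ?_⟩, ?_, ?_, ?_⟩
  · rintro q w ⟨x, f', n', hfn, hf, he⟩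
    simp at he
  · rintro (⟨x, f, n⟩ | q) w w' hw hw'
    · rw [((hrule x f n w).1 hw).2.2, ((hrule x f n w').1 hw').2.2]
    · obtain ⟨x, f', n', hfn, hf, he⟩ := hw
      simp at he
  · rintro _ ⟨x, f, n, hfn, hf, rfl⟩
    exact ⟨⟨x, f, n, rfl⟩, _, _, _, rfl⟩
  · have claim : ∀ s : LTree ℕ, ∀ p a, (hp : (p, a) ∈ copies W) → DomP c p.1 (some s) →
        ∃ y, T.Ev s ⟨(p, a), hp⟩ y ∧
          ∀ it ∈ p.2.getD a [], ItemSat c it (some s) (some y) := by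
      intro s
      induction s with
      | node f n d ih =>
        intro p a hp hd
        obtain ⟨hf, hkids⟩ := domP_kids hd
        obtain ⟨hp1, ha⟩ := mem_copies.1 hp
        obtain ⟨ho, hv, ht⟩ := h1 p hp1 f n hf a ha
        have hlt : ∀ l : Fin (o p f n a).2.length, (o p f n a).2[l] < n := fun l =>
          (mem_opts.1 ho).2 _ (List.getElem_mem _)
        have hsub : ∀ l : Fin (o p f n a).2.length, ∃ y,
            T.Ev (d ⟨_, hlt l⟩) (emb (t p f n a l)) y ∧
            ∀ it ∈ nextTask c p.1 f n (p.2.getD a []) (o p f n a) l,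
              ItemSat c it (some (d ⟨_, hlt l⟩)) (some y) := by
          intro l
          obtain ⟨g1, g2, g3⟩ := ht l ((o p f n a).2[l]) (by simp)
          obtain ⟨g4, g5⟩ := List.getElem?_eq_some_iff.1 g3
          have hcop : t p f n a l ∈ copies W := mem_copies.2 ⟨g1, g4⟩
          obtain ⟨y, hy, hsat⟩ := ih ⟨_, hlt l⟩ _ _ hcop (by
            have hk := hkids (⟨_, hlt l⟩ : Fin n)
            rw [okid_node_fin] at hk
            rwa [g2])
          refine ⟨y, by rwa [hemb hcop], ?_⟩
          have : (t p f n a l).1.2.getD (t p f n a l).2 [] =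
              nextTask c p.1 f n (p.2.getD a []) (o p f n a) l := by
            simp [List.getD_eq_getElem?_getD, g3]
          rwa [this] at hsat
        choose y hy hsat using hsub
        refine ⟨.node (o p f n a).1 _ y, TDT.ev_node_iff.2 ⟨_, _, _,
          (hrule _ f n _).2 ⟨hf.mem, hf, rfl⟩, rfl, rfl, fun l => ⟨_, _, okid_node_fin f n d
            ⟨_, hlt l⟩, okid_node_fin _ _ _ _, hy l⟩⟩,
          itemSat_of_kids hA hv hd rfl rfl fun i k hik it hit => ?_⟩
        obtain ⟨hil, rfl⟩ := List.getElem?_eq_some_iff.1 hik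
        have := hsat ⟨i, hil⟩ it hit
        have e1 := okid_node_fin f n d ⟨_, hlt ⟨i, hil⟩⟩
        have e2 := okid_node_fin (o p f n a).1 _ y ⟨i, hil⟩
        simp only [Fin.getElem_fin] at e1 e2 this
        rwa [e1, e2]
    intro s hs
    exact claim s _ _ hi hs
  · have claim : ∀ s ∈ trees c.1, ∀ p ∈ W, (∀ a < p.2.length, ∃ y, T.Ev s (emb (p, a)) y) →
        InB c s p.1 := by
      intro s
      induction s with
      | node f n d ih =>
        intro hs p hp hall
        rw [mem_trees_node] at hs
        have hval : ∀ a < p.2.length, Feas c p.1 f n ∧ ∀ i k, (o p f n a).2[i]? = some k →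
            ∃ s' y', okid (some (LTree.node f n d)) k = some s' ∧
              T.Ev s' (emb (t p f n a i)) y' := by
          intro a ha
          obtain ⟨y, hy⟩ := hall a ha
          rw [hemb (mem_copies.2 ⟨hp, ha⟩)] at hy
          obtain ⟨g, m, κ, hr, -, -, hl⟩ := TDT.ev_node_iff.1 hy
          obtain ⟨-, hf, hw⟩ := (hrule _ _ _ _).1 hr
          refine ⟨hf, fun i k hik => ?_⟩
          simp only [rhs, Term.node.injEq] at hw
          obtain ⟨rfl, rfl, hκ⟩ := hw
          obtain ⟨hil, hik'⟩ := List.getElem?_eq_some_iff.1 hik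
          have hκi := congrFun (eq_of_heq hκ) ⟨i, hil⟩
          simp only [Term.leaf.injEq] at hκi
          obtain ⟨s', y', e1, -, e3⟩ := hl ⟨i, hil⟩
          rw [hκi] at e1 e3
          simp only [Fin.getElem_fin, hik'] at e1
          exact ⟨s', y', e1, e3⟩
        have hf : Feas c p.1 f n := by
          rcases hW p hp (f, n) hs.1 with h | ⟨-, hne⟩
          · exact h.1
          · exact (hval 0 (List.length_pos_iff.2 hne)).1
        refine ⟨hf, fun k => ?_⟩
        obtain ⟨p', hp', hpd, hb⟩ := h2 p hp f n hf k k.2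
        rw [← hpd]
        refine ih k (hs.2 k) p' hp' fun b hbl => ?_
        obtain ⟨a, ha, i, hik, htb⟩ := hb b hbl
        obtain ⟨s', y', e1, e2⟩ := (hval a ha).2 i k hik
        rw [okid_node_fin, Option.some.injEq] at e1
        subst e1
        rw [htb] at e2
        exact ⟨y', e2⟩
    rintro s hs ⟨y, hy⟩
    refine claim s hs _ h₀ fun a ha => ?_
    obtain rfl : a = 0 := by simpa using ha
    rw [hemb hi]
    exact ⟨y, hy⟩

end Soundness

/-! ### Computability of the certificates -/

-- The tactic `fun_prop` is used for functions composed of projections and elementary operations.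
attribute [fun_prop] Primrec

section Combinators

variable {α β γ δ : Type} [Primcodable α] [Primcodable β] [Primcodable γ] [Primcodable δ]

@[fun_prop] lemma primrec_id : Primrec fun x : α => x := Primrec.id

@[fun_prop] lemma primrec_const (y : β) : Primrec fun _ : α => y := Primrec.const y

@[fun_prop] lemma primrec_comp {f : β → γ} {g : α → β} (hf : Primrec f) (hg : Primrec g) :
    Primrec fun a => f (g a) := hf.comp hg

@[fun_prop] lemma primrec_fst {f : α → β × γ} (hf : Primrec f) : Primrec fun a => (f a).1 :=
  Primrec.fst.comp hf

@[fun_prop] lemma primrec_snd {f : α → β × γ} (hf : Primrec f) : Primrec fun a => (f a).2 :=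
  Primrec.snd.comp hf

@[fun_prop] lemma primrec_pair {f : α → β} {g : α → γ} (hf : Primrec f) (hg : Primrec g) :
    Primrec fun a => (f a, g a) := hf.pair hg

@[fun_prop] lemma primrec_some {f : α → β} (hf : Primrec f) : Primrec fun a => some (f a) :=
  Primrec.option_some.comp hf

@[fun_prop] lemma primrec_isSome {f : α → Option β} (hf : Primrec f) :
    Primrec fun a => (f a).isSome := Primrec.option_isSome.comp hf

@[fun_prop] lemma primrec_or {f g : α → Bool} (hf : Primrec f) (hg : Primrec g) :
    Primrec fun a => f a || g a := Primrec.or.comp hf hg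

@[fun_prop] lemma primrec_max {f g : α → ℕ} (hf : Primrec f) (hg : Primrec g) :
    Primrec fun a => max (f a) (g a) := Primrec.nat_max.comp hf hg

@[fun_prop] lemma primrec_length {f : α → List β} (hf : Primrec f) :
    Primrec fun a => (f a).length := Primrec.list_length.comp hf

@[fun_prop] lemma primrec_range {f : α → ℕ} (hf : Primrec f) :
    Primrec fun a => List.range (f a) := Primrec.list_range.comp hf

@[fun_prop] lemma primrec_cons {f : α → β} {g : α → List β} (hf : Primrec f) (hg : Primrec g) :
    Primrec fun a => f a :: g a := Primrec.list_cons.comp hf hg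

@[fun_prop] lemma primrec_getD {f : α → List β} {g : α → ℕ} (hf : Primrec f) (hg : Primrec g)
    (d : β) : Primrec fun a => (f a).getD (g a) d := (Primrec.list_getD d).comp hf hg

@[fun_prop] lemma primrec_getElem? {f : α → List β} {g : α → ℕ} (hf : Primrec f)
    (hg : Primrec g) : Primrec fun a => (f a)[g a]? := Primrec.list_getElem?.comp hf hg

@[fun_prop] lemma primrec_flatten {f : α → List (List β)} (hf : Primrec f) :
    Primrec fun a => (f a).flatten := Primrec.list_flatten.comp hf

lemma primrec_map {f : α → List β} {g : α → β → γ} (hf : Primrec f)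
    (hg : Primrec fun x : α × β => g x.1 x.2) : Primrec fun a => (f a).map fun b => g a b :=
  Primrec.list_map hf hg

lemma primrec_flatMap {f : α → List β} {g : α → β → List γ} (hf : Primrec f)
    (hg : Primrec fun x : α × β => g x.1 x.2) : Primrec fun a => (f a).flatMap fun b => g a b :=
  Primrec.list_flatMap hf hg

@[fun_prop] lemma primrec_product {f : α → List β} {g : α → List γ} (hf : Primrec f)
    (hg : Primrec g) : Primrec fun a => f a ×ˢ g a :=
  primrec_flatMap hf (primrec_map (by fun_prop) (by fun_prop))

lemma primrecPred_eq {f g : α → β} (hf : Primrec f) (hg : Primrec g) :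
    PrimrecPred fun a => f a = g a := Primrec.eq.comp hf hg

lemma primrecPred_lt {f g : α → ℕ} (hf : Primrec f) (hg : Primrec g) :
    PrimrecPred fun a => f a < g a := Primrec.nat_lt.comp hf hg

lemma primrecPred_le {f g : α → ℕ} (hf : Primrec f) (hg : Primrec g) :
    PrimrecPred fun a => f a ≤ g a := Primrec.nat_le.comp hf hg

lemma primrecPred_imp {p q : α → Prop} (hp : PrimrecPred p) (hq : PrimrecPred q) :
    PrimrecPred fun a => p a → q a :=
  (hp.not.or hq).of_eq fun _ => imp_iff_not_or.symm

lemma primrecPred_exists {f : α → List β} {p : α → β → Prop} (hf : Primrec f)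
    (hp : PrimrecPred fun x : α × β => p x.1 x.2) : PrimrecPred fun a => ∃ b ∈ f a, p a b :=
  (PrimrecRel.exists_mem_list (R := fun b a => p a b)
    (hp.comp (Primrec.snd.pair Primrec.fst))).comp hf Primrec.id

lemma primrecPred_forall {f : α → List β} {p : α → β → Prop} (hf : Primrec f)
    (hp : PrimrecPred fun x : α × β => p x.1 x.2) : PrimrecPred fun a => ∀ b ∈ f a, p a b :=
  (PrimrecRel.forall_mem_list (R := fun b a => p a b)
    (hp.comp (Primrec.snd.pair Primrec.fst))).comp hf Primrec.id

lemma primrecPred_exists_lt {f : α → ℕ} {p : α → ℕ → Prop} (hf : Primrec f)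
    (hp : PrimrecPred fun x : α × ℕ => p x.1 x.2) : PrimrecPred fun a => ∃ k < f a, p a k :=
  (primrecPred_exists (primrec_range hf) hp).of_eq fun a => by simp

lemma primrecPred_forall_lt {f : α → ℕ} {p : α → ℕ → Prop} (hf : Primrec f)
    (hp : PrimrecPred fun x : α × ℕ => p x.1 x.2) : PrimrecPred fun a => ∀ k < f a, p a k :=
  (primrecPred_forall (primrec_range hf) hp).of_eq fun a => by simp

lemma primrecPred_mem {f : α → β} {g : α → List β} (hf : Primrec f) (hg : Primrec g) :
    PrimrecPred fun a => f a ∈ g a :=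
  (primrecPred_exists hg (p := fun a b => b = f a) (primrecPred_eq (by fun_prop)
    (by fun_prop))).of_eq fun a => by simp

lemma primrec_decide {p : α → Prop} {inst : DecidablePred p} (hp : PrimrecPred p) :
    Primrec fun a => decide (p a) := hp.decide

lemma primrec_filter {f : α → List β} {p : α → β → Prop} {inst : ∀ a, DecidablePred (p a)}
    (hf : Primrec f) (hp : PrimrecPred fun x : α × β => p x.1 x.2) :
    Primrec fun a => (f a).filter fun b => decide (p a b) := by
  let _ : DecidableRel fun b a => p a b := fun b a => inst a b
  exact (PrimrecRel.listFilter (R := fun b a => p a b)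
    (hp.comp (Primrec.snd.pair Primrec.fst))).comp hf Primrec.id

@[fun_prop] lemma primrec_sec {f : α → List (List β)} (hf : Primrec f) :
    Primrec fun a => sec (f a) := by
  have : Primrec fun a => (f a).foldr
      (fun (l : List β) (acc : List (List β)) => l.flatMap fun b => acc.map (b :: ·)) [[]] := by
    refine Primrec.list_foldr (h := fun _ (x : List β × List (List β)) =>
      x.1.flatMap fun b => x.2.map fun l => b :: l) hf (primrec_const _) ?_
    exact primrec_flatMap (f := fun y : α × List β × List (List β) => y.2.1)
      (g := fun y b => y.2.2.map fun l => b :: l) (by fun_prop)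
      (primrec_map (by fun_prop) (by fun_prop))
  refine this.of_eq fun a => ?_
  induction f a with
  | nil => rfl
  | cons l L ih => rw [List.foldr_cons, ih]; rfl

@[fun_prop] lemma primrec_pw {f : α → List β} (hf : Primrec f) : Primrec fun a => pw (f a) := by
  refine primrec_map (primrec_sec (primrec_map hf ?_)) ?_ <;> fun_prop

lemma primrec_lfpList {f : α → List β} {Φ : α → List β → β → Prop} (hf : Primrec f)
    (hΦ : PrimrecPred fun x : α × List β × β => Φ x.1 x.2.1 x.2.2) :
    Primrec fun a => lfpList (f a) (Φ a) := by
  unfold lfpList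
  refine primrec_filter hf (primrecPred_forall (by fun_prop) (primrecPred_imp
    (primrecPred_forall (by fun_prop) (primrecPred_imp ?_ (primrecPred_mem ?_ ?_)))
    (primrecPred_mem ?_ ?_)))
  · exact hΦ.comp (f := fun x : ((α × β) × List β) × β => (x.1.1.1, x.1.2, x.2)) (by fun_prop)
  all_goals fun_prop

lemma primrec_gfpList {f : α → List β} {Φ : α → List β → β → Prop} (hf : Primrec f)
    (hΦ : PrimrecPred fun x : α × List β × β => Φ x.1 x.2.1 x.2.2) :
    Primrec fun a => gfpList (f a) (Φ a) := by
  unfold gfpList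
  refine primrec_filter hf (primrecPred_exists (by fun_prop) (.and
    (primrecPred_forall (by fun_prop) ?_) (primrecPred_mem ?_ ?_)))
  · exact hΦ.comp (f := fun x : ((α × β) × List β) × β => (x.1.1.1, x.1.2, x.2)) (by fun_prop)
  all_goals fun_prop

end Combinators

section Certificates

variable {α : Type} [Primcodable α]

@[fun_prop] lemma primrec_trans {f : α → Ctx} (hf : Primrec f) : Primrec fun a => (f a).trans := by
  have : Primrec fun A : TopDownTA (Option ℕ × Option ℕ) => (TopDownTA.equivProd _ A).2.2 :=
    Primrec.snd.comp (Primrec.snd.comp Primrec.of_equiv)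
  exact this.comp (by fun_prop)

@[fun_prop] lemma primrec_letters {f : α → RankedAlphabet} (hf : Primrec f) :
    Primrec fun a => letters (f a) :=
  primrec_cons (by fun_prop) (primrec_map (f := f) hf (by fun_prop))

lemma primrecPred_trMatch {t : α → Tr} {q : α → ℕ} {a b : α → Option ℕ} {n : α → ℕ}
    (ht : Primrec t) (hq : Primrec q) (ha : Primrec a) (hb : Primrec b) (hn : Primrec n) :
    PrimrecPred fun x => TrMatch (t x) (q x) (a x) (b x) (n x) :=
  (primrecPred_eq (by fun_prop) (by fun_prop)).and
    ((primrecPred_eq (by fun_prop) (by fun_prop)).and (primrecPred_eq (by fun_prop) (by fun_prop)))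

lemma primrec_prodList : Primrec prodList := by
  refine primrec_lfpList (Φ := ProdStep) (primrec_product (primrec_map (by fun_prop)
    (by fun_prop)) (by fun_prop)) ?_
  unfold ProdStep
  refine primrecPred_exists (by fun_prop) (primrecPred_exists (by fun_prop)
    (primrecPred_exists (by fun_prop) (.and (.and (primrecPred_eq ?_ ?_)
      (.and (primrecPred_eq ?_ ?_) (primrecPred_eq ?_ ?_))) (.and
      (primrecPred_trMatch ?_ ?_ ?_ ?_ ?_) (primrecPred_forall_lt ?_ (primrecPred_mem
        (primrec_pair ?_ (primrec_pair (primrec_decide (primrecPred_lt ?_ ?_))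
          (primrec_decide (primrecPred_lt ?_ ?_)))) ?_))))))
  all_goals fun_prop

lemma primrec_exps : Primrec exps := by
  have := primrec_prodList
  unfold exps
  refine primrec_cons (by fun_prop) (primrec_map (primrec_filter (by fun_prop) (.and
    (primrecPred_trMatch ?_ ?_ ?_ ?_ ?_) (primrecPred_forall_lt ?_ (primrecPred_mem
        (primrec_pair ?_ (primrec_pair (primrec_decide (primrecPred_lt ?_ ?_))
          (primrec_decide (primrecPred_lt ?_ ?_)))) ?_))))
    (primrec_pair ?_ (primrec_pair ?_ (primrec_map ?_ (primrec_some (primrec_pair ?_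
      (primrec_decide (primrecPred_lt ?_ ?_))))))))
  all_goals fun_prop

lemma primrec_succStates : Primrec succStates :=
  primrec_flatMap (by fun_prop) (by fun_prop)

lemma primrec_srcList : Primrec srcList := by
  have := primrec_exps
  exact primrec_cons (by fun_prop) (primrec_flatMap (by fun_prop) (by fun_prop))

lemma primrec_padList : Primrec padList := by
  have := primrec_exps
  have := primrec_succStates
  have := primrec_srcList
  refine primrec_gfpList (Φ := PadStep) (by fun_prop) ?_
  unfold PadStep
  refine .and (primrecPred_eq ?_ ?_) (primrecPred_forall ?_ (primrecPred_imp
    (primrecPred_eq ?_ ?_) (primrecPred_exists ?_ (.and (primrecPred_trMatch ?_ ?_ ?_ ?_ ?_)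
    (primrecPred_forall_lt ?_ (primrecPred_mem ?_ ?_))))))
  all_goals fun_prop

lemma primrec_itemList : Primrec itemList := by
  have := primrec_succStates
  have := primrec_srcList
  exact primrec_product (by fun_prop) (primrec_cons (by fun_prop) (primrec_map (by fun_prop)
    (by fun_prop)))

variable {c : α → Ctx} {P : α → List Src} {f n k : α → ℕ} {S : α → Task} {o : α → Opt}

lemma primrecPred_expMatch {x : α → Option Src} {e : α → Exp} (hP : Primrec P) (hf : Primrec f)
    (hn : Primrec n) (hx : Primrec x) (he : Primrec e) :
    PrimrecPred fun a => ExpMatch (P a) (f a) (n a) (x a) (e a) := by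
  unfold ExpMatch
  refine .or (.and (primrecPred_eq ?_ ?_) (.and (primrecPred_mem ?_ ?_) (.and
    (primrecPred_eq ?_ ?_) (primrecPred_eq ?_ ?_)))) (primrecPred_eq ?_ ?_)
  all_goals fun_prop

lemma primrecPred_feas (hc : Primrec c) (hP : Primrec P) (hf : Primrec f) (hn : Primrec n) :
    PrimrecPred fun a => Feas (c a) (P a) (f a) (n a) := by
  have := primrec_exps
  refine primrecPred_exists ?_ (primrecPred_expMatch ?_ ?_ ?_ ?_ ?_)
  all_goals fun_prop

lemma primrec_delta (hc : Primrec c) (hP : Primrec P) (hf : Primrec f) (hn : Primrec n)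
    (hk : Primrec k) : Primrec fun a => delta (c a) (P a) (f a) (n a) (k a) := by
  have := primrec_exps
  refine primrec_map (primrec_filter ?_ (primrecPred_expMatch ?_ ?_ ?_ ?_ ?_)) ?_
  all_goals fun_prop

lemma primrec_kidSrc {x : α → Option Src} {d : α → List ℕ} {e : α → Exp} (hx : Primrec x)
    (hd : Primrec d) (he : Primrec e) (hk : Primrec k) :
    Primrec fun a => kidSrc (x a) (d a) (e a) (k a) := by
  unfold kidSrc
  refine Primrec.ite (.and (primrecPred_eq ?_ ?_) (primrecPred_eq ?_ ?_)) ?_ ?_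
  all_goals fun_prop

lemma primrecPred_valid (hc : Primrec c) (hP : Primrec P) (hf : Primrec f) (hn : Primrec n)
    (hS : Primrec S) (ho : Primrec o) :
    PrimrecPred fun a => Valid (c a) (P a) (f a) (n a) (S a) (o a) := by
  have := primrec_exps
  have := primrec_padList
  unfold Valid
  refine primrecPred_forall ?_ (primrecPred_forall ?_ (primrecPred_imp
    (primrecPred_expMatch ?_ ?_ ?_ ?_ ?_) (primrecPred_exists ?_ (.and
    (primrecPred_trMatch ?_ ?_ ?_ ?_ ?_) (primrecPred_forall_lt ?_ (primrecPred_imp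
    (primrecPred_le ?_ ?_) (primrecPred_mem ?_ ?_)))))))
  all_goals fun_prop

lemma primrec_nextTask (hc : Primrec c) (hP : Primrec P) (hf : Primrec f) (hn : Primrec n)
    (hS : Primrec S) (ho : Primrec o) (hk : Primrec k) :
    Primrec fun a => nextTask (c a) (P a) (f a) (n a) (S a) (o a) (k a) := by
  have := primrec_exps
  have := primrec_itemList
  unfold nextTask ItemStep
  refine primrec_filter ?_ (primrecPred_exists ?_ (primrecPred_exists ?_ (.and
    (primrecPred_expMatch ?_ ?_ ?_ ?_ ?_) (primrecPred_exists ?_ (.and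
    (primrecPred_trMatch ?_ ?_ ?_ ?_ ?_) (primrecPred_eq ?_ (primrec_pair ?_
    (primrec_kidSrc ?_ ?_ ?_ ?_))))))))
  all_goals fun_prop

lemma primrec_opts (hc : Primrec c) (hn : Primrec n) : Primrec fun a => opts (c a) (n a) := by
  have hrep : ∀ m l, List.replicate m (List.range l) = (List.range m).map fun _ => List.range l :=
    fun m l => by simp
  simp only [opts, hrep]
  refine primrec_flatMap ?_ (primrec_map (primrec_sec (primrec_map ?_ ?_)) ?_)
  all_goals fun_prop

lemma primrec_moves (hc : Primrec c) (hP : Primrec P) (hf : Primrec f) (hn : Primrec n)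
    (hS : Primrec S) : Primrec fun a => moves (c a) (P a) (f a) (n a) (S a) := by
  refine primrec_map (primrec_filter (primrec_opts ?_ ?_) (primrecPred_valid ?_ ?_ ?_ ?_ ?_ ?_)) ?_
  all_goals fun_prop

lemma primrec_nextTasks {z : α → List (Task × Opt)} (hc : Primrec c) (hP : Primrec P)
    (hf : Primrec f) (hn : Primrec n) (hk : Primrec k) (hz : Primrec z) :
    Primrec fun a => nextTasks (c a) (P a) (f a) (n a) (k a) (z a) := by
  unfold nextTasks
  refine primrec_flatMap ?_ (primrec_map (primrec_filter ?_ (primrecPred_eq ?_ ?_))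
    (primrec_nextTask ?_ ?_ ?_ ?_ ?_ ?_ ?_))
  all_goals fun_prop

lemma primrecPred_yesCert : PrimrecPred fun x : Ctx × List Pos => YesCert x.1 x.2 := by
  unfold YesCert
  refine primrecPred_forall ?_ (primrecPred_forall ?_ (.or (.and (primrecPred_feas ?_ ?_ ?_ ?_)
    (primrecPred_exists (primrec_sec (primrec_map ?_ (primrec_moves ?_ ?_ ?_ ?_ ?_)))
    (primrecPred_forall_lt ?_ (primrecPred_exists ?_ (.and
      (primrecPred_eq ?_ (primrec_delta ?_ ?_ ?_ ?_ ?_))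
      (.and (primrecPred_mem ?_ (primrec_pw (primrec_nextTasks ?_ ?_ ?_ ?_ ?_ ?_)))
      (primrecPred_forall (primrec_nextTasks ?_ ?_ ?_ ?_ ?_ ?_) (primrecPred_mem ?_ ?_))))))))
    (.and (.not (primrecPred_feas ?_ ?_ ?_ ?_)) (.not (primrecPred_eq ?_ ?_)))))
  all_goals fun_prop

lemma primrecPred_noCert : PrimrecPred fun x : Ctx × List (Pos × ℕ) => NoCert x.1 x.2 := by
  unfold NoCert
  refine primrecPred_forall ?_ (primrecPred_exists ?_ (.or
    (.and (.not (primrecPred_feas ?_ ?_ ?_ ?_)) (primrecPred_eq ?_ ?_))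
    (.and (primrecPred_feas ?_ ?_ ?_ ?_) (primrecPred_forall
      (primrec_sec (primrec_map ?_ (primrec_moves ?_ ?_ ?_ ?_ ?_)))
      (primrecPred_exists_lt ?_ (primrecPred_exists ?_ (.and (primrecPred_eq ?_ (primrec_pair
        (primrec_delta ?_ ?_ ?_ ?_ ?_) (primrec_nextTasks ?_ ?_ ?_ ?_ ?_ ?_)))
        (primrecPred_lt ?_ ?_))))))))
  all_goals fun_prop

end Certificates

/-! ### The decision procedure -/

/-- The initial state of the automaton. -/
def Ctx.initState (c : Ctx) : ℕ := c.2.2.init.headI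

/-- The initial position: the valid inputs are those that have an output with which they are
accepted from the initial state, and one copy of the transducer has to produce such an output. -/
def Ctx.root (c : Ctx) : Pos := ([some (c.initState, true)], [[(c.initState, none)]])

lemma primrec_root : Primrec Ctx.root := by
  have : Primrec fun A : TopDownTA (Option ℕ × Option ℕ) => (TopDownTA.equivProd _ A).2.1 :=
    Primrec.fst.comp (Primrec.snd.comp Primrec.of_equiv)
  have hinit : Primrec Ctx.initState :=
    Primrec.list_headI.comp (this.comp (f := _) (g := fun c : Ctx => c.2.2) (by fun_prop))
  unfold Ctx.root
  fun_prop

/-- It is decidable whether the initial position is lost: both answers have finite certificates,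
and one of these exists for every instance. -/
theorem computablePred_lose : ComputablePred fun c : Ctx => Lose c c.root.1 c.root.2 := by
  classical
  have hroot := primrec_root
  let yes (c : Ctx) (m : ℕ) : Prop :=
    ∃ W ∈ (Encodable.decode (α := List Pos) m).toList, YesCert c W ∧ c.root ∈ W
  let no (c : Ctx) (m : ℕ) : Prop :=
    ∃ N ∈ (Encodable.decode (α := List (Pos × ℕ)) m).toList, NoCert c N ∧ ∃ p ∈ N, p.1 = c.root
  have hyes : PrimrecPred fun x : Ctx × ℕ => yes x.1 x.2 := by
    refine primrecPred_exists (Primrec.optionToList.comp (Primrec.decode.comp Primrec.snd)) (.and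
      (primrecPred_yesCert.comp (f := fun y : (Ctx × ℕ) × List Pos => (y.1.1, y.2)) ?_)
      (primrecPred_mem ?_ ?_))
    all_goals fun_prop
  have hno : PrimrecPred fun x : Ctx × ℕ => no x.1 x.2 := by
    refine primrecPred_exists (Primrec.optionToList.comp (Primrec.decode.comp Primrec.snd)) (.and
      (primrecPred_noCert.comp (f := fun y : (Ctx × ℕ) × List (Pos × ℕ) => (y.1.1, y.2)) ?_)
      (primrecPred_exists ?_ (primrecPred_eq ?_ ?_)))
    all_goals fun_prop
  have no_lose : ∀ c m, no c m → Lose c c.root.1 c.root.2 := by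
    rintro c m ⟨N, -, hN, p, hp, he⟩
    have := lose_of_noCert hN hp
    rwa [he] at this
  have yes_not_lose : ∀ c m, yes c m → ¬ Lose c c.root.1 c.root.2 := by
    rintro c m ⟨W, -, hW, hr⟩
    exact hW.not_lose hr
  have total : ∀ c, ∃ m, yes c m ∨ no c m := by
    intro c
    by_cases h : Lose c c.root.1 c.root.2
    · obtain ⟨N, hN, r, hr⟩ := exists_noCert h
      exact ⟨Encodable.encode N, .inr ⟨N, by simp, hN, _, hr, rfl⟩⟩
    · obtain ⟨W, hW, hr⟩ := exists_yesCert h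
      exact ⟨Encodable.encode W, .inl ⟨W, by simp, hW, hr⟩⟩
  have hfind := Computable.find (P := fun c m => yes c m ∨ no c m)
    (hyes.or hno).computablePred total
  refine computablePred_iff_computable_decide.2 ?_
  refine (hno.decide.to_comp.comp (Computable.id.pair hfind)).of_eq fun c => ?_
  refine decide_eq_decide.2 ⟨no_lose _ _, fun hl => ?_⟩
  exact (Nat.find_spec (total c)).resolve_left fun hy => yes_not_lose _ _ hy hl

/-- Under the assumptions of the decision problem, a uniformizer exists if and only if the initial
position of the game is not lost. -/
theorem hasUniformization_iff {S G : RankedAlphabet} {A : TopDownTA (Option ℕ × Option ℕ)}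
    {R : Set (LTree ℕ × LTree ℕ)} (hR : RecognizesRel S G A R)
    (hB : ∃ B : TopDownTA ℕ, RecognizesLang S B (relDom R)) :
    HasUniformizationWithoutDelay S G R ↔
      ¬ Lose (S, G, A) (Ctx.root (S, G, A)).1 (Ctx.root (S, G, A)).2 := by
  classical
  obtain ⟨q₀, hq₀⟩ := hR.2.2.1.1
  have hinit : Ctx.initState (S, G, A) = q₀ := by
    rw [← hq₀, Ctx.initState]
    have : q₀ ∈ A.init := (hq₀ q₀).2 rfl
    cases hA : A.init with
    | nil => rw [hA] at this; simp at this
    | cons a l => simp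
  set c : Ctx := (S, G, A) with hc
  have hdet : c.2.2.Deterministic := hR.2.2.1
  have hmem := mem_rel_iff hR hq₀
  have hroot : c.root = ([some (q₀, true)], [[(q₀, none)]]) := by rw [Ctx.root, hinit]
  rw [hroot]
  have hdom : ∀ s, DomP c [some (q₀, true)] (some s) ↔ s ∈ relDom R := by
    intro s
    constructor
    · rintro ⟨x, hx, hd⟩
      obtain rfl := List.mem_singleton.1 hx
      obtain ⟨ot, h1, h2, h3, h4, h5⟩ := hd
      obtain ⟨t, rfl⟩ := Option.isSome_iff_exists.1 h2
      exact ⟨t, (hmem s t).2 ⟨by simpa using h3, by simpa using h4, h5⟩⟩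
    · rintro ⟨t, ht⟩
      obtain ⟨h1, h2, h3⟩ := (hmem s t).1 ht
      exact ⟨_, List.mem_singleton.2 rfl, some t, rfl, rfl, by simpa using h1, by simpa using h2,
        h3⟩
  have hclosed : Closed c [some (q₀, true)] := by
    obtain ⟨B, -, hBd, hBl⟩ := hB
    obtain ⟨p, hp⟩ := hBd.1
    refine closed_of_runFrom hBd (p := p) fun s => ?_
    rw [hdom, ← hBl]
    constructor
    · rintro ⟨h1, q, hq, h2⟩
      rw [hp] at hq
      subst hq
      exact ⟨h1, h2⟩
    · rintro ⟨h1, h2⟩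
      exact ⟨h1, p, (hp p).2 rfl, h2⟩
  constructor
  · rintro ⟨Q, -, T, F, hT, hTd, hrel, hFd, hFR⟩
    have hF : ∀ s t, t ∈ F s ↔ s ∈ trees S ∧ T.Ev s T.init t := fun s t => by
      rw [← TDT.mem_relation_iff hTd, hrel]
      exact Iff.rfl
    refine not_lose_of_fulfils (c := c) (T := T) hdet hT hclosed (.inl (by simp))
      (rs := [T.init]) (.cons ?_ .nil) fun s hs hall => ?_
    · intro s hs
      have hs' : s ∈ F.Dom := by
        rw [hFd]
        exact (hdom s).1 hs
      obtain ⟨t, ht⟩ := Part.dom_iff_mem.1 hs'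
      refine ⟨t, ((hF s t).1 ht).2, fun it hit => ?_⟩
      obtain rfl := List.mem_singleton.1 hit
      exact ((hmem s t).1 (hFR s t ht)).2.2
    · obtain ⟨t, ht⟩ := hall _ (List.mem_singleton.2 rfl)
      exact (hdom s).2 ⟨t, hFR s t ((hF s t).2 ⟨hs, ht⟩)⟩
  · intro hl
    obtain ⟨W, hW, hW₀⟩ := exists_yesCert hl
    obtain ⟨Q, hQ, T, hT, hTd, hful, hval⟩ := hW.exists_transducer hdet hW₀
    let F : LTree ℕ →. LTree ℕ := fun s =>
      ⟨∃ t, (s, t) ∈ T.relation, fun h => h.choose⟩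
    have hF : ∀ s t, t ∈ F s ↔ (s, t) ∈ T.relation := by
      intro s t
      constructor
      · rintro ⟨h, rfl⟩
        exact h.choose_spec
      · intro h
        have hex : ∃ t, (s, t) ∈ T.relation := ⟨t, h⟩
        exact ⟨hex, TDT.ev_unique hT ((TDT.mem_relation_iff hTd).1 hex.choose_spec).2
          ((TDT.mem_relation_iff hTd).1 h).2⟩
    have hsub : ∀ s t, (s, t) ∈ T.relation → (s, t) ∈ R := by
      intro s t h
      obtain ⟨hs, ht⟩ := (TDT.mem_relation_iff hTd).1 h
      have hd := hclosed s (hval s hs ⟨t, ht⟩)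
      obtain ⟨t', ht', hsat⟩ := hful s hd
      obtain rfl := TDT.ev_unique hT ht ht'
      exact (hmem s t).2 ⟨hs, TDT.ev_mem_trees ht, hsat _ (List.mem_singleton.2 rfl)⟩
    refine ⟨Q, hQ, T, F, hT, hTd, ?_, ?_, fun s t h => hsub s t ((hF s t).1 h)⟩
    · ext ⟨s, t⟩
      exact (hF s t).symm
    · ext s
      constructor
      · rintro ⟨t, ht⟩
        exact ⟨t, hsub s t ht⟩
      · intro hs
        have hd := (hdom s).2 hs
        obtain ⟨t, ht, -⟩ := hful s hd
        exact ⟨t, (TDT.mem_relation_iff hTd).2 ⟨hd.mem_trees, ht⟩⟩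

end TreeUnif

theorem mainTheorem3 :
    ∃ decide : TreeUnif.RankedAlphabet × TreeUnif.RankedAlphabet ×
        TreeUnif.TopDownTA (Option ℕ × Option ℕ) → Bool,
      Computable decide ∧
      ∀ (S G : TreeUnif.RankedAlphabet) (A : TreeUnif.TopDownTA (Option ℕ × Option ℕ))
        (R : Set (TreeUnif.LTree ℕ × TreeUnif.LTree ℕ)),
        TreeUnif.RecognizesRel S G A R →
        (∃ B : TreeUnif.TopDownTA ℕ, TreeUnif.RecognizesLang S B (TreeUnif.relDom R)) →
        (decide (S, G, A) = true ↔ TreeUnif.HasUniformizationWithoutDelay S G R) := by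
  obtain ⟨d, hd, he⟩ := ComputablePred.computable_iff.1 TreeUnif.computablePred_lose.not
  refine ⟨d, hd, fun S G A R hR hB => ?_⟩
  rw [TreeUnif.hasUniformization_iff hR hB]
  exact (iff_of_eq (congrFun he (S, G, A))).symm
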